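/- **Setting.** Let $[m]=\{1,\dots,m\}$ be the base arms, $\mathcal I$ a nonempty family of subsets of $[m]$ (the feasible super arms), and $\mathcal D$ a class of probability distributions on $[0,1]^m$. In each round $t$ the learner plays $S(t)\in\mathcal I$, an outcome vector $X(t)\sim D$ is drawn independently of the past, a random set $S'(t)\supseteq S(t)$ of triggered arms is drawn from $D^{\mathrm{trig}}(S(t),X(t))$, the reward is $R(S'(t),X(t))$, and the outcomes $X_i(t)$, $i\in S'(t)$, are observed. Here $D\in\mathcal D$ is unknown to the learner and $\mathcal I,D^{\mathrm{trig}},R$ are known. Write $\mu_i=\mathbb E_D[X_i]$, let $p_i^{D,S}$ be the probability that arm $i$ is triggered when $S$ is played under $D$, and let $\tilde S=\{i: p_i^{D,S}>0\}$. Arms are triggered by triggered arms: for $S\in\mathcal I$ and $A\subseteq[m]$, the probability that $D^{\mathrm{trig}}(S,x)$ equals $A$ depends on $x$ only through the coordinates $x_i$ with $i\in A$ whose outcome is $\{0,1\}$-valued under every $D\in\mathcal D$. **Algorithm.** Combinatorial Thompson Sampling (CTS) starts with $a_i=b_i=1$ for all $i$. In round $t$ it draws independent $\theta_i(t)\sim\mathrm{Beta}(a_i,b_i)$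 and plays $S(t)=\mathrm{Oracle}(\theta(t))$, where $\mathrm{Oracle}(\theta)\in\arg\max_{S\in\mathcal I} r(S,\theta)$ for all $\theta\in[0,1]^m$, with $r$ as in assumption 2 below. For every $i\in S'(t)$ it then tosses an independent coin $Y_i$ with success probability $X_i(t)$ and replaces $(a_i,b_i)$ by $(a_i+Y_i,b_i+1-Y_i)$. **Assumptions.** 1. Under every $D\in\mathcal D$ the outcomes of the base arms are mutually independent. 2. There is a function $r$ such that, for every $D\in\mathcal D$ with mean vector $\mu$, the expected reward of playing $S\in\mathcal I$ is $r(S,\mu)$. 3. (Triggering-probability-modulated Lipschitz continuity) There is $B'>0$ such that for every $S\in\mathcal I$ and all $D,D'\in\mathcal D$ with mean vectors $\mu,\mu'$, $|r(S,\mu)-r(S,\mu')|\le B'\sum_{i\in\tilde S}p_i^{D,S}|\mu_i-\mu_i'|$, where $\tilde S$ is taken under $D$. 4. (Monotonicity) $r(S,\mu)\le r(S,\mu')$ for every $S\in\mathcal I$ and all mean vectors $\mu,\mu'$ of distributions in $\mathcal D$ with $\mu_i\le\mu_i'$ for all $i$. **Theorem.** Let $D$ be drawn from a prior on $\mathcal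 D$ under which the mean vector $\mu$ is uniformly distributed on $[0,1]^m$. Then for every $T$ the Bayesian regret $\mathrm{BayReg}(T)=\mathbb E\big[\sum_{t=1}^T\big(\max_{S\in\mathcal I}r(S,\mu)-r(S(t),\mu)\big)\big]$ of CTS is well defined and satisfies $$\mathrm{BayReg}(T)\le 16mB'(1+\sqrt2)\sqrt{(1+4\log T)\,T}+4mB'+8m^2B'.$$ -/

import Mathlib

open MeasureTheory ProbabilityTheory Set

namespace CMAB

/-! ### The problem -/

/-- A combinatorial multi-armed bandit with probabilistically triggered arms: base arms `Fin m`, and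
a class of outcome distributions on `[0,1]^m` indexed by `Θ` (the possible environments). -/
structure Bandit (m : ℕ) (Θ : Type*) [MeasurableSpace Θ] where
  /-- The feasible super arms. -/
  superArms : Finset (Finset (Fin m))
  superArms_nonempty : superArms.Nonempty
  /-- The outcome distribution of each environment. -/
  outcome : Kernel Θ (Fin m → ℝ)
  outcome_isMarkov : IsMarkovKernel outcome
  outcome_mem : ∀ e, ∀ᵐ x ∂(outcome e), x ∈ Icc (0 : Fin m → ℝ) 1
  /-- `trig (S, x)` is the law of the set of triggered arms when `S` is played and the outcome
  vector is `x`. -/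
  trig : Kernel (Finset (Fin m) × (Fin m → ℝ)) (Finset (Fin m))
  trig_isMarkov : IsMarkovKernel trig
  trig_superset : ∀ S ∈ superArms, ∀ x ∈ Icc (0 : Fin m → ℝ) 1, ∀ᵐ A ∂(trig (S, x)), S ⊆ A
  /-- The reward, a function of the triggered set and the outcome vector. -/
  reward : Finset (Fin m) → (Fin m → ℝ) → ℝ
  reward_measurable : ∀ A, Measurable (reward A)

attribute [instance] Bandit.outcome_isMarkov Bandit.trig_isMarkov

namespace Bandit

variable {m : ℕ} {Θ : Type*} [MeasurableSpace Θ] (𝓑 : Bandit m Θ)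

/-- The mean outcome vector of the environment `e`. -/
noncomputable def mean (e : Θ) (i : Fin m) : ℝ := ∫ x, x i ∂(𝓑.outcome e)

/-- Joint law of the outcome vector and the triggered set when `S` is played in `e`. -/
noncomputable def feedback (e : Θ) (S : Finset (Fin m)) :
    Measure ((Fin m → ℝ) × Finset (Fin m)) :=
  𝓑.outcome e ⊗ₘ 𝓑.trig.sectR S

/-- Probability that the base arm `i` is triggered when `S` is played in `e`. -/
noncomputable def trigProb (e : Θ) (S : Finset (Fin m)) (i : Fin m) : ℝ :=
  (𝓑.feedback e S).real {q | i ∈ q.2}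

open Classical in
/-- The triggering set of `S` in `e`. -/
noncomputable def trigSet (e : Θ) (S : Finset (Fin m)) : Finset (Fin m) :=
  Finset.univ.filter fun i => 0 < 𝓑.trigProb e S i

/-- The outcomes of the base arms are mutually independent. -/
def IndependentOutcomes : Prop :=
  ∀ e, iIndepFun (fun (i : Fin m) (x : Fin m → ℝ) => x i) (𝓑.outcome e)

/-- The outcome of the base arm `i` is always `0` or `1`. -/
def IsBinary (i : Fin m) : Prop := ∀ e, ∀ᵐ x ∂(𝓑.outcome e), x i = 0 ∨ x i = 1

/-- Arms are triggered by triggered arms: the chance that exactly the arms in `A` are triggered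
depends on the outcomes of arms in `A` only, and only through those that are binary. -/
def CascadeTriggering : Prop :=
  ∀ S ∈ 𝓑.superArms, ∀ A : Finset (Fin m),
    ∀ x ∈ Icc (0 : Fin m → ℝ) 1, ∀ y ∈ Icc (0 : Fin m → ℝ) 1,
      (∀ i ∈ A, 𝓑.IsBinary i → x i = y i) → 𝓑.trig (S, x) {A} = 𝓑.trig (S, y) {A}

/-- The expected reward of each super arm `S` is `r S μ`, where `μ` is the mean outcome vector. -/
def IsExpectedReward (r : Finset (Fin m) → (Fin m → ℝ) → ℝ) : Prop :=
  ∀ e, ∀ S ∈ 𝓑.superArms,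
    Integrable (fun q : (Fin m → ℝ) × Finset (Fin m) => 𝓑.reward q.2 q.1) (𝓑.feedback e S) ∧
      ∫ q, 𝓑.reward q.2 q.1 ∂(𝓑.feedback e S) = r S (𝓑.mean e)

/-- Triggering-probability-modulated Lipschitz continuity with constant `B`. -/
def TPMLipschitz (r : Finset (Fin m) → (Fin m → ℝ) → ℝ) (B : ℝ) : Prop :=
  ∀ S ∈ 𝓑.superArms, ∀ e e' : Θ,
    |r S (𝓑.mean e) - r S (𝓑.mean e')| ≤
      B * ∑ i ∈ 𝓑.trigSet e S, 𝓑.trigProb e S i * |𝓑.mean e i - 𝓑.mean e' i|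

/-- Monotonicity of the expected reward in the mean outcome vector. -/
def MonotoneReward (r : Finset (Fin m) → (Fin m → ℝ) → ℝ) : Prop :=
  ∀ S ∈ 𝓑.superArms, ∀ e e' : Θ,
    (∀ i, 𝓑.mean e i ≤ 𝓑.mean e' i) → r S (𝓑.mean e) ≤ r S (𝓑.mean e')

/-- `oracle` returns an optimal super arm for every parameter vector. -/
def IsExactOracle (r : Finset (Fin m) → (Fin m → ℝ) → ℝ)
    (oracle : (Fin m → ℝ) → Finset (Fin m)) : Prop :=
  ∀ θ ∈ Icc (0 : Fin m → ℝ) 1,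
    oracle θ ∈ 𝓑.superArms ∧ ∀ S ∈ 𝓑.superArms, r S θ ≤ r (oracle θ) θ

/-- The mean outcome vector is uniformly distributed on `[0,1]^m` under `prior`. -/
def UniformMeanPrior (prior : Measure Θ) : Prop :=
  prior.map 𝓑.mean = (volume : Measure (Fin m → ℝ)).restrict (Icc 0 1)

/-- Suboptimality gap of the super arm `S` in the environment `e`. -/
noncomputable def gap (r : Finset (Fin m) → (Fin m → ℝ) → ℝ) (e : Θ) (S : Finset (Fin m)) : ℝ :=
  (𝓑.superArms.sup' 𝓑.superArms_nonempty fun S' => r S' (𝓑.mean e)) - r S (𝓑.mean e)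

end Bandit

/-! ### Coins and posterior samples -/

/-- Bernoulli law with success probability `x ∈ [0,1]` (other `x` are projected onto `[0,1]`). -/
noncomputable def coin (x : ℝ) : Measure Bool :=
  ENNReal.ofReal (max 0 (min x 1)) • Measure.dirac true +
    ENNReal.ofReal (1 - max 0 (min x 1)) • Measure.dirac false

instance coin_isProb (x : ℝ) : IsProbabilityMeasure (coin x) := by
  constructor
  have h0 : 0 ≤ max 0 (min x 1) := le_max_left _ _
  have h1 : 0 ≤ 1 - max 0 (min x 1) := by
    rw [sub_nonneg]; exact max_le zero_le_one (min_le_right _ _)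
  simp only [coin, Measure.coe_add, Measure.coe_smul, Pi.add_apply, Pi.smul_apply, measure_univ,
    smul_eq_mul, mul_one]
  rw [← ENNReal.ofReal_add h0 h1, add_sub_cancel, ENNReal.ofReal_one]

lemma measurable_coin : Measurable coin := by
  refine Measure.measurable_of_measurable_coe _ fun s hs => ?_
  simp only [coin, Measure.coe_add, Measure.coe_smul, Pi.add_apply, Pi.smul_apply, smul_eq_mul]
  fun_prop

/-- Independent coins, the `i`-th one with success probability `x i`. -/
noncomputable def coins (m : ℕ) : Kernel (Fin m → ℝ) (Fin m → Bool) where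
  toFun x := Measure.pi fun i => coin (x i)
  measurable' := by
    refine Measure.measurable_of_measurable_coe _ fun s hs => ?_
    have h : ∀ x : Fin m → ℝ, (Measure.pi fun i => coin (x i)) s =
        ∑ y : Fin m → Bool, s.indicator (fun y => ∏ i, coin (x i) {y i}) y := by
      intro x
      rw [← Measure.tsum_indicator_apply_singleton _ s hs, tsum_fintype]
      simp only [Measure.pi_singleton]
    simp only [h]
    refine Finset.measurable_sum _ fun y _ => ?_
    by_cases hy : y ∈ s
    · simp only [indicator_of_mem hy]
      exact Finset.measurable_prod _ fun i _ =>
        (Measure.measurable_coe (measurableSet_singleton (y i))).comp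
          (measurable_coin.comp (measurable_pi_apply i))
    · simp only [indicator_of_notMem hy, measurable_const]

instance coins_isMarkov (m : ℕ) : IsMarkovKernel (coins m) :=
  ⟨fun x => inferInstanceAs (IsProbabilityMeasure (Measure.pi fun i => coin (x i)))⟩

/-- Independent samples, the `i`-th one from the Beta distribution with parameters
`1 + c.1 i` and `1 + c.2 i`. -/
noncomputable def betaSample (m : ℕ) : Kernel ((Fin m → ℕ) × (Fin m → ℕ)) (Fin m → ℝ) where
  toFun c := Measure.pi fun i => betaMeasure (1 + c.1 i) (1 + c.2 i)
  measurable' := measurable_of_countable _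

instance betaSample_isMarkov (m : ℕ) : IsMarkovKernel (betaSample m) := by
  refine ⟨fun c => ?_⟩
  have : ∀ i, IsProbabilityMeasure (betaMeasure (1 + (c.1 i : ℝ)) (1 + (c.2 i : ℝ))) :=
    fun i => isProbabilityMeasureBeta (by positivity) (by positivity)
  exact inferInstanceAs
    (IsProbabilityMeasure (Measure.pi fun i => betaMeasure (1 + (c.1 i : ℝ)) (1 + (c.2 i : ℝ))))

/-! ### Combinatorial Thompson sampling -/

/-- The record of one round: the sampled parameter vector, the outcome vector, the triggered set,
and the coin of every base arm. -/
abbrev Round (m : ℕ) : Type :=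
  (Fin m → ℝ) × (Fin m → ℝ) × Finset (Fin m) × (Fin m → Bool)

/-- Number of past rounds in which the base arm `i` was triggered and its coin showed `v`. -/
def count {m t : ℕ} (v : Bool) (h : Fin t → Round m) (i : Fin m) : ℕ :=
  (Finset.univ.filter fun s : Fin t => i ∈ (h s).2.2.1 ∧ (h s).2.2.2 i = v).card

lemma measurable_count {m t : ℕ} (v : Bool) :
    Measurable fun h : Fin t → Round m => count v h := by
  refine measurable_pi_lambda _ fun i => ?_
  simp only [count, Finset.card_filter]
  refine Finset.measurable_sum _ fun s _ => Measurable.ite ?_ measurable_const measurable_const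
  have hs : Measurable fun h : Fin t → Round m => ((h s).2.2.1, (h s).2.2.2) := by fun_prop
  exact hs (t := {q : Finset (Fin m) × (Fin m → Bool) | i ∈ q.1 ∧ q.2 i = v})
    (Set.toFinite _).measurableSet

variable {m : ℕ} {Θ : Type*} [MeasurableSpace Θ]

/-- One round of combinatorial Thompson sampling in the environment `e` after the history `h`:
`θ` is drawn from the Beta posterior, the outcome vector `x` from the environment; the super arm
`oracle θ` is played and triggers a random set; and, given `x`, independent coins with success
probabilities `x i` are tossed (only those of the triggered arms will enter the posterior). -/
noncomputable def roundKernel (𝓑 : Bandit m Θ) {oracle : (Fin m → ℝ) → Finset (Fin m)}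
    (ho : Measurable oracle) (t : ℕ) : Kernel (Θ × (Fin t → Round m)) (Round m) :=
  (betaSample m).comap (fun p : Θ × (Fin t → Round m) => (count true p.2, count false p.2))
      (((measurable_count true).comp measurable_snd).prodMk
        ((measurable_count false).comp measurable_snd)) ⊗ₖ
    (𝓑.outcome.comap (fun p : (Θ × (Fin t → Round m)) × (Fin m → ℝ) => p.1.1) (by fun_prop) ⊗ₖ
      (𝓑.trig.comap
          (fun p : ((Θ × (Fin t → Round m)) × (Fin m → ℝ)) × (Fin m → ℝ) => (oracle p.1.2, p.2))
          (by fun_prop) ×ₖ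
        (coins m).comap
          (fun p : ((Θ × (Fin t → Round m)) × (Fin m → ℝ)) × (Fin m → ℝ) => p.2)
          (by fun_prop)))

instance roundKernel_isMarkov (𝓑 : Bandit m Θ) {oracle : (Fin m → ℝ) → Finset (Fin m)}
    (ho : Measurable oracle) (t : ℕ) : IsMarkovKernel (roundKernel 𝓑 ho t) := by
  unfold roundKernel; infer_instance

lemma measurable_snoc (m t : ℕ) : Measurable fun q : (Fin t → Round m) × Round m =>
    (Fin.snoc q.1 q.2 : Fin (t + 1) → Round m) := by
  refine measurable_pi_lambda _ fun s => ?_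
  refine Fin.lastCases ?_ (fun j => ?_) s
  · simp only [Fin.snoc_last]; fun_prop
  · simp only [Fin.snoc_castSucc]; fun_prop

/-- Law of the first `t` rounds of combinatorial Thompson sampling, in each environment. -/
noncomputable def historyKernel (𝓑 : Bandit m Θ) {oracle : (Fin m → ℝ) → Finset (Fin m)}
    (ho : Measurable oracle) : (t : ℕ) → Kernel Θ (Fin t → Round m)
  | 0 => Kernel.const Θ (Measure.dirac Fin.elim0)
  | t + 1 => (historyKernel 𝓑 ho t ⊗ₖ roundKernel 𝓑 ho t).map
      fun q : (Fin t → Round m) × Round m => (Fin.snoc q.1 q.2 : Fin (t + 1) → Round m)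

instance historyKernel_isMarkov (𝓑 : Bandit m Θ) {oracle : (Fin m → ℝ) → Finset (Fin m)}
    (ho : Measurable oracle) (t : ℕ) : IsMarkovKernel (historyKernel 𝓑 ho t) := by
  induction t with
  | zero => unfold historyKernel; infer_instance
  | succ t ih => unfold historyKernel; exact Kernel.IsMarkovKernel.map _ (measurable_snoc m t)

/-- Joint law of the environment, drawn from `prior`, and of the first `T` rounds. -/
noncomputable def bayesLaw (𝓑 : Bandit m Θ) {oracle : (Fin m → ℝ) → Finset (Fin m)}
    (ho : Measurable oracle) (prior : Measure Θ) (T : ℕ) : Measure (Θ × (Fin T → Round m)) :=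
  prior ⊗ₘ historyKernel 𝓑 ho T

/-- Total gap of the super arms played in `T` rounds in the environment `ω.1`. -/
noncomputable def pseudoRegret (𝓑 : Bandit m Θ) (r : Finset (Fin m) → (Fin m → ℝ) → ℝ)
    (oracle : (Fin m → ℝ) → Finset (Fin m)) (T : ℕ) (ω : Θ × (Fin T → Round m)) : ℝ :=
  ∑ t : Fin T, 𝓑.gap r ω.1 (oracle (ω.2 t).1)

/-- The Bayesian regret by round `T`. -/
noncomputable def bayesRegret (𝓑 : Bandit m Θ) (r : Finset (Fin m) → (Fin m → ℝ) → ℝ)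
    {oracle : (Fin m → ℝ) → Finset (Fin m)} (ho : Measurable oracle) (prior : Measure Θ) (T : ℕ) :
    ℝ :=
  ∫ ω, pseudoRegret 𝓑 r oracle T ω ∂(bayesLaw 𝓑 ho prior T)

end CMAB

/-! Thompson sampling with Beta(1,1) priors is exact posterior sampling, even though only triggered
arms are observed. If a round triggers exactly `A`, the triggering probability depends only on
binary outcomes of arms in `A`. For such arms the coin reproduces the outcome, so that probability
is fixed by the recorded coins and does not depend on the environment. With independent arms, the
likelihood of the counts is therefore an environment-free factor times `∏ μᵢ^aᵢ (1 - μᵢ)^bᵢ`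
(`exists_feedback_likelihood`, `exists_history_likelihood`). Under a uniform prior, the law of `μ`
given the counts is the product of Beta laws from which `θ` is drawn (`lintegral_posterior`).

Hence `E max_S r(S, μ) = E max_S r(S, θ) = E r(S(t), θ)`, and the regret of a round is `E[r(S(t), θ)
- r(S(t), μ)] ≤ B E ∑ pᵢ |θᵢ - μᵢ|`. No confidence intervals are needed. With `Nᵢ` the number of
earlier triggerings of arm `i`, weighted AM-GM gives `pᵢ |δ| ≤ (c/2) pᵢ/(Nᵢ+1) + (Nᵢ+1) δ²/(2c)` for
every `c > 0`. The square term has mean at most 1 by the Beta variance (`integral_pulls_mul_sq_le`).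
The first term has as its mean the expected increase of the harmonic number of `Nᵢ`
(`integral_trigProb_div_pulls`), so it telescopes to at most `1 + log T`. Choosing `c = √(T/(1 + log
T))` gives `m B √((1 + log T) T)`, which is below the stated bound.

One technical point: `r` is controlled only at mean vectors of environments, and `θ` need not be
one. The argument runs with a continuous extension `g` of `r`. Because the mean vector is uniform,
measurable statements true at every mean vector hold for almost every `θ`. -/

namespace CMAB

/-! ### Products of densities -/

lemma lintegral_pi_prod_eq_prod {ι : Type*} [Fintype ι] {X : ι → Type*}
    [∀ i, MeasurableSpace (X i)] (u : ∀ i, Measure (X i)) [∀ i, IsProbabilityMeasure (u i)]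
    (f : ∀ i, X i → ENNReal) (hf : ∀ i, Measurable (f i)) :
    ∫⁻ x, ∏ i, f i (x i) ∂(Measure.pi u) = ∏ i, ∫⁻ y, f i y ∂(u i) := by
  have hind : iIndepFun (fun i (x : ∀ i, X i) => f i (x i)) (Measure.pi u) :=
    iIndepFun_pi fun i => (hf i).aemeasurable
  rw [lintegral_prod_eq_prod_lintegral_of_indepFun Finset.univ _ hind
    (fun i => (hf i).comp (measurable_pi_apply i))]
  refine Finset.prod_congr rfl fun i _ => ?_
  rw [← (measurePreserving_eval u i).map_eq, lintegral_map (hf i) (measurable_pi_apply i)]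

lemma pi_withDensity {ι : Type*} [Fintype ι] {X : ι → Type*}
    [∀ i, MeasurableSpace (X i)] (u : ∀ i, Measure (X i)) [∀ i, IsProbabilityMeasure (u i)]
    (f : ∀ i, X i → ENNReal) (hf : ∀ i, Measurable (f i))
    [∀ i, SigmaFinite ((u i).withDensity (f i))] :
    Measure.pi (fun i => (u i).withDensity (f i)) =
      (Measure.pi u).withDensity fun x => ∏ i, f i (x i) := by
  refine Measure.pi_eq (μ := fun i => (u i).withDensity (f i)) fun s hs => ?_
  rw [withDensity_apply _ (MeasurableSet.univ_pi hs),
    ← lintegral_indicator (MeasurableSet.univ_pi hs)]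
  have h : ∀ x : ∀ i, X i, (univ.pi s).indicator (fun x => ∏ i, f i (x i)) x =
      ∏ i, (s i).indicator (f i) (x i) := by
    intro x
    by_cases hx : x ∈ univ.pi s
    · rw [indicator_of_mem hx]
      exact Finset.prod_congr rfl fun i _ => (indicator_of_mem (hx i (mem_univ i)) _).symm
    · rw [indicator_of_notMem hx]
      simp only [mem_univ_pi, not_forall] at hx
      obtain ⟨i, hi⟩ := hx
      exact (Finset.prod_eq_zero (Finset.mem_univ i) (indicator_of_notMem hi _)).symm
  simp only [h]
  rw [lintegral_pi_prod_eq_prod u _ fun i => (hf i).indicator (hs i)]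
  refine Finset.prod_congr rfl fun i _ => ?_
  rw [lintegral_indicator (hs i), withDensity_apply _ (hs i)]

/-! ### The Beta distribution as a posterior -/

/-- Likelihood of `a` successes and `b` failures when the success probability is `x`. -/
noncomputable def coinLikelihood (a b : ℕ) (x : ℝ) : ENNReal :=
  ENNReal.ofReal x ^ a * ENNReal.ofReal (1 - x) ^ b

lemma measurable_coinLikelihood (a b : ℕ) : Measurable (coinLikelihood a b) := by
  unfold coinLikelihood; fun_prop

/-- The uniform distribution on `[0,1]`. -/
noncomputable def unitUniform : Measure ℝ := volume.restrict (Icc 0 1)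

instance unitUniform_isProb : IsProbabilityMeasure unitUniform :=
  ⟨by simp [unitUniform]⟩

lemma beta_one_add_pos (a b : ℕ) : 0 < beta (1 + a) (1 + b) :=
  beta_pos (by positivity) (by positivity)

/-- Beta(1,1) is uniform, so with parameters shifted by 1 the Beta density is a normalized coin
likelihood. The endpoints, where the Beta density is set to zero but the likelihood may not vanish,
form a null set. -/
lemma betaMeasure_eq_withDensity (a b : ℕ) :
    betaMeasure (1 + a) (1 + b) = unitUniform.withDensity fun x =>
      ENNReal.ofReal (1 / beta (1 + a) (1 + b)) * coinLikelihood a b x := by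
  have hIoo : unitUniform = volume.restrict (Ioo 0 1) := restrict_Ioo_eq_restrict_Icc.symm
  have h : betaPDF (1 + a) (1 + b) = (Ioo (0 : ℝ) 1).indicator fun x =>
      ENNReal.ofReal (1 / beta (1 + a) (1 + b)) * coinLikelihood a b x := by
    ext x
    by_cases hx : x ∈ Ioo (0 : ℝ) 1
    · have hb : (0 : ℝ) ≤ 1 / beta (1 + a) (1 + b) := (one_div_pos.2 (beta_one_add_pos a b)).le
      rw [indicator_of_mem hx, betaPDF_of_pos_lt_one hx.1 hx.2, coinLikelihood,
        ← ENNReal.ofReal_pow hx.1.le, ← ENNReal.ofReal_pow (by linarith [hx.2]),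
        ← ENNReal.ofReal_mul (pow_nonneg hx.1.le _), ← ENNReal.ofReal_mul hb, mul_assoc]
      congr 3
      · rw [add_sub_cancel_left, Real.rpow_natCast]
      · rw [add_sub_cancel_left, Real.rpow_natCast]
    · rw [indicator_of_notMem hx, betaPDF_eq, if_neg (by exact hx), ENNReal.ofReal_zero]
  rw [betaMeasure, h, withDensity_indicator measurableSet_Ioo, hIoo]

/-- The uniform distribution on `[0,1]^m`. -/
noncomputable def cubeUniform (m : ℕ) : Measure (Fin m → ℝ) := Measure.pi fun _ => unitUniform

instance cubeUniform_isProb (m : ℕ) : IsProbabilityMeasure (cubeUniform m) :=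
  inferInstanceAs (IsProbabilityMeasure (Measure.pi fun _ => unitUniform))

lemma cubeUniform_eq (m : ℕ) :
    cubeUniform m = (volume : Measure (Fin m → ℝ)).restrict (Icc 0 1) := by
  rw [cubeUniform, ← pi_univ_Icc, volume_pi, Measure.restrict_pi_pi]
  rfl

/-- Likelihood of the counts `c.1` of successes and `c.2` of failures for the mean vector `x`. -/
noncomputable def likelihood {m : ℕ} (c : (Fin m → ℕ) × (Fin m → ℕ)) (x : Fin m → ℝ) : ENNReal :=
  ∏ i, coinLikelihood (c.1 i) (c.2 i) (x i)

lemma measurable_likelihood {m : ℕ} (c : (Fin m → ℕ) × (Fin m → ℕ)) :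
    Measurable (likelihood c) :=
  Finset.measurable_prod _ fun i _ =>
    (measurable_coinLikelihood _ _).comp (measurable_pi_apply i)

lemma likelihood_add {m : ℕ} (c d : (Fin m → ℕ) × (Fin m → ℕ)) (x : Fin m → ℝ) :
    likelihood (c + d) x = likelihood c x * likelihood d x := by
  simp only [likelihood, ← Finset.prod_mul_distrib]
  refine Finset.prod_congr rfl fun i _ => ?_
  simp only [coinLikelihood, Prod.fst_add, Prod.snd_add, Pi.add_apply, pow_add]
  ring

lemma likelihood_zero {m : ℕ} (x : Fin m → ℝ) : likelihood 0 x = 1 := by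
  simp [likelihood, coinLikelihood]

/-- Normalizing constant of the posterior. -/
noncomputable def evidence {m : ℕ} (c : (Fin m → ℕ) × (Fin m → ℕ)) : ENNReal :=
  ∏ i, ENNReal.ofReal (beta (1 + c.1 i) (1 + c.2 i))

lemma betaSample_eq_withDensity {m : ℕ} (c : (Fin m → ℕ) × (Fin m → ℕ)) :
    betaSample m c = (cubeUniform m).withDensity fun x => (evidence c)⁻¹ * likelihood c x := by
  have hv : ∀ i, IsProbabilityMeasure (unitUniform.withDensity fun x =>
      ENNReal.ofReal (1 / beta (1 + c.1 i) (1 + c.2 i)) * coinLikelihood (c.1 i) (c.2 i) x) := by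
    intro i
    rw [← betaMeasure_eq_withDensity]
    exact isProbabilityMeasureBeta (by positivity) (by positivity)
  change Measure.pi (fun i => betaMeasure (1 + c.1 i) (1 + c.2 i)) = _
  simp only [betaMeasure_eq_withDensity]
  rw [pi_withDensity _ _ fun i => (measurable_coinLikelihood _ _).const_mul _, cubeUniform]
  congr 1
  ext x
  rw [Finset.prod_mul_distrib, likelihood]
  congr 1
  rw [evidence, ENNReal.prod_inv_distrib]
  · refine Finset.prod_congr rfl fun i _ => ?_
    rw [one_div, ENNReal.ofReal_inv_of_pos (beta_one_add_pos _ _)]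
  · exact fun _ _ _ _ _ => Or.inr ENNReal.ofReal_ne_top

lemma evidence_ne_zero {m : ℕ} (c : (Fin m → ℕ) × (Fin m → ℕ)) : evidence c ≠ 0 :=
  Finset.prod_ne_zero_iff.2 fun i _ => by
    simpa using beta_one_add_pos (c.1 i) (c.2 i)

lemma evidence_ne_top {m : ℕ} (c : (Fin m → ℕ) × (Fin m → ℕ)) : evidence c ≠ ⊤ :=
  ENNReal.prod_ne_top fun _ _ => ENNReal.ofReal_ne_top

/-- Bayes' rule: prior times likelihood is evidence times posterior. -/
lemma lintegral_mul_likelihood {m : ℕ} (c : (Fin m → ℕ) × (Fin m → ℕ))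
    (f : (Fin m → ℝ) → ENNReal) (hf : Measurable f) :
    ∫⁻ x, f x * likelihood c x ∂(cubeUniform m) =
      evidence c * ∫⁻ x, f x ∂(betaSample m c) := by
  have hl := measurable_likelihood c
  rw [betaSample_eq_withDensity, lintegral_withDensity_eq_lintegral_mul _ (hl.const_mul _) hf,
    ← lintegral_const_mul _ ((hl.const_mul _).mul hf)]
  refine lintegral_congr fun x => ?_
  simp only [Pi.mul_apply]
  rw [mul_assoc, ← mul_assoc, ENNReal.mul_inv_cancel (evidence_ne_zero c) (evidence_ne_top c),
    one_mul, mul_comm]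

lemma betaSample_absolutelyContinuous {m : ℕ} (c : (Fin m → ℕ) × (Fin m → ℕ)) :
    betaSample m c ≪ cubeUniform m := by
  rw [betaSample_eq_withDensity]
  exact withDensity_absolutelyContinuous _ _

lemma ae_betaMeasure_mem_Icc (a b : ℕ) : ∀ᵐ x ∂(betaMeasure (1 + a) (1 + b)), x ∈ Icc (0 : ℝ) 1 := by
  rw [betaMeasure_eq_withDensity]
  exact (withDensity_absolutelyContinuous _ _).ae_le (ae_restrict_mem measurableSet_Icc)

/-! ### Moments of the Beta distribution -/

lemma beta_succ_left {α β : ℝ} (hα : 0 < α) (hβ : 0 < β) :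
    beta (1 + α) β = α / (α + β) * beta α β := by
  have h := (Real.Gamma_pos_of_pos (add_pos hα hβ)).ne'
  have h2 : α + β ≠ 0 := (add_pos hα hβ).ne'
  rw [beta, beta, add_comm 1 α, add_right_comm α 1 β, Real.Gamma_add_one hα.ne',
    Real.Gamma_add_one h2]
  field_simp

lemma integral_betaMeasure (α β : ℝ) (hα : 0 < α) (hβ : 0 < β) (f : ℝ → ℝ) :
    ∫ x, f x ∂(betaMeasure α β) = ∫ x, betaPDFReal α β x * f x := by
  have h0 : ∀ x, 0 ≤ betaPDFReal α β x := fun x => by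
    by_cases hx : 0 < x ∧ x < 1
    · exact (betaPDFReal_pos hx.1 hx.2 hα hβ).le
    · rw [betaPDFReal, if_neg hx]
  have hm : Measurable (betaPDF α β) := (measurable_betaPDFReal α β).ennreal_ofReal
  rw [betaMeasure, integral_withDensity_eq_integral_toReal_smul hm
    (ae_of_all _ fun x => ENNReal.ofReal_lt_top)]
  refine integral_congr_ae (ae_of_all _ fun x => ?_)
  simp only [betaPDF, ENNReal.toReal_ofReal (h0 x), smul_eq_mul]

/-- A factor `x` raises the exponent in the density by one; the prefactor is the ratio of the
normalizing constants. Applied repeatedly, this yields all moments. -/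
lemma integral_id_mul_betaMeasure {α β : ℝ} (hα : 0 < α) (hβ : 0 < β) (f : ℝ → ℝ) :
    ∫ x, x * f x ∂(betaMeasure α β) = α / (α + β) * ∫ x, f x ∂(betaMeasure (1 + α) β) := by
  rw [integral_betaMeasure α β hα hβ, integral_betaMeasure (1 + α) β (by positivity) hβ,
    ← integral_const_mul]
  refine integral_congr_ae (ae_of_all _ fun x => ?_)
  by_cases hx : 0 < x ∧ x < 1
  · simp only [betaPDFReal, if_pos hx, beta_succ_left hα hβ]
    have hb := (beta_pos hα hβ).ne'
    have hab := (add_pos hα hβ).ne'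
    have hp : x ^ (1 + α - 1) = x ^ (α - 1) * x := by
      rw [← Real.rpow_add_one hx.1.ne']; congr 1; ring
    rw [hp]
    field_simp
  · simp only [betaPDFReal, if_neg hx, zero_mul, mul_zero]

lemma integral_sq_sub_mean_betaMeasure (a b : ℕ) :
    ∫ x : ℝ, (x - (1 + a) / (2 + a + b)) ^ 2 ∂(betaMeasure (1 + a) (1 + b)) =
      ((1 + a) * (1 + b) / ((2 + a + b) ^ 2 * (3 + a + b)) : ℝ) := by
  have ha : (0 : ℝ) < 1 + a := by positivity
  have hb : (0 : ℝ) < 1 + b := by positivity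
  have hP := isProbabilityMeasureBeta ha hb
  have hP1 := isProbabilityMeasureBeta (α := 1 + (1 + a)) (by positivity) hb
  have hP2 := isProbabilityMeasureBeta (α := 1 + (1 + (1 + a))) (by positivity) hb
  have h1 : ∫ x : ℝ, x ∂(betaMeasure (1 + a) (1 + b)) = (1 + a) / (2 + a + b) := by
    have := integral_id_mul_betaMeasure ha hb fun _ => 1
    simp only [mul_one, integral_const, probReal_univ, smul_eq_mul] at this
    rw [this]; congr 1; ring
  have h2 : ∫ x : ℝ, x * x ∂(betaMeasure (1 + a) (1 + b)) =
      (1 + a) / (2 + a + b) * ((2 + a) / (3 + a + b)) := by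
    have e1 := integral_id_mul_betaMeasure ha hb fun x => x
    have e2 := integral_id_mul_betaMeasure (α := 1 + (1 + a)) (by positivity) hb fun _ => 1
    simp only [mul_one, integral_const, probReal_univ, smul_eq_mul] at e2
    rw [e1, e2]; congr 2 <;> ring
  have hbd : ∀ᵐ x ∂(betaMeasure (1 + a) (1 + b)), x ∈ Icc (0 : ℝ) 1 :=
    ae_betaMeasure_mem_Icc a b
  have i1 : Integrable (fun x : ℝ => x) (betaMeasure (1 + a) (1 + b)) :=
    Integrable.of_bound measurable_id.aestronglyMeasurable 1 (hbd.mono fun x hx => by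
      rw [Real.norm_eq_abs, abs_le]; constructor <;> linarith [hx.1, hx.2])
  have i2 : Integrable (fun x : ℝ => x * x) (betaMeasure (1 + a) (1 + b)) :=
    Integrable.of_bound (by fun_prop) 1 (hbd.mono fun x hx => by
      rw [Real.norm_eq_abs, abs_le]; constructor <;> nlinarith [hx.1, hx.2])
  have e : ∀ x : ℝ, (x - (1 + a) / (2 + a + b)) ^ 2 =
      x * x - 2 * ((1 + a) / (2 + a + b)) * x + ((1 + a) / (2 + a + b)) ^ 2 := fun x => by ring
  simp only [e]
  have i3 : Integrable (fun x : ℝ => 2 * ((1 + a) / (2 + a + b)) * x)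
      (betaMeasure (1 + a) (1 + b)) := i1.const_mul _
  have i4 : Integrable (fun x : ℝ => x * x - 2 * ((1 + a) / (2 + a + b)) * x)
      (betaMeasure (1 + a) (1 + b)) := i2.sub i3
  rw [integral_add i4 (integrable_const _), integral_sub i2 i3, integral_const_mul, h1, h2]
  simp only [integral_const, probReal_univ, smul_eq_mul, one_mul]
  have : (2 + a + b : ℝ) ≠ 0 := by positivity
  have : (3 + a + b : ℝ) ≠ 0 := by positivity
  field_simp
  ring

/-- Mean of the Beta posterior of the arm `i` after the counts `c`. -/
noncomputable def postMean {m : ℕ} (c : (Fin m → ℕ) × (Fin m → ℕ)) (i : Fin m) : ℝ :=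
  (1 + c.1 i) / (2 + c.1 i + c.2 i)

/-- The Beta variance is `(1+a)(1+b)/((2+a+b)²(3+a+b))`. By AM-GM it is at most `1/(4(3+a+b))`,
which absorbs the weight `a+b+1`. -/
lemma lintegral_sq_sub_postMean_betaSample_le {m : ℕ} (c : (Fin m → ℕ) × (Fin m → ℕ))
    (i : Fin m) :
    ∫⁻ x, ENNReal.ofReal ((c.1 i + c.2 i + 1) * (x i - postMean c i) ^ 2) ∂(betaSample m c) ≤
      ENNReal.ofReal (1 / 4) := by
  have hP : ∀ i, IsProbabilityMeasure (betaMeasure (1 + (c.1 i : ℝ)) (1 + (c.2 i : ℝ))) :=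
    fun i => isProbabilityMeasureBeta (by positivity) (by positivity)
  have hmp := measurePreserving_eval (fun i => betaMeasure (1 + (c.1 i : ℝ)) (1 + (c.2 i : ℝ))) i
  have hm : Measurable fun y : ℝ =>
      ENNReal.ofReal ((c.1 i + c.2 i + 1) * (y - postMean c i) ^ 2) := by fun_prop
  have h1 : ∫⁻ x, ENNReal.ofReal ((c.1 i + c.2 i + 1) * (x i - postMean c i) ^ 2)
      ∂(betaSample m c) = ∫⁻ y, ENNReal.ofReal ((c.1 i + c.2 i + 1) * (y - postMean c i) ^ 2)
        ∂(betaMeasure (1 + (c.1 i : ℝ)) (1 + (c.2 i : ℝ))) := by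
    rw [← hmp.map_eq, lintegral_map hm (measurable_pi_apply i)]
    rfl
  have hi : Integrable (fun y : ℝ => (c.1 i + c.2 i + 1) * (y - postMean c i) ^ 2)
      (betaMeasure (1 + (c.1 i : ℝ)) (1 + (c.2 i : ℝ))) := by
    refine Integrable.const_mul (Integrable.of_bound (by fun_prop) 1
      ((ae_betaMeasure_mem_Icc _ _).mono fun y hy => ?_)) _
    have hp0 : 0 ≤ postMean c i := by unfold postMean; positivity
    have hp1 : postMean c i ≤ 1 := by
      unfold postMean
      rw [div_le_one (by positivity)]
      have : (0 : ℝ) ≤ c.2 i := by positivity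
      linarith
    rw [Real.norm_eq_abs, abs_of_nonneg (sq_nonneg _)]
    nlinarith [hy.1, hy.2]
  rw [h1, ← ofReal_integral_eq_lintegral_ofReal hi (ae_of_all _ fun y => by positivity)]
  refine ENNReal.ofReal_le_ofReal ?_
  rw [integral_const_mul]
  simp only [postMean]
  rw [integral_sq_sub_mean_betaMeasure, mul_div_assoc',
    div_le_div_iff₀ (by positivity) (by norm_num)]
  have ha : (0 : ℝ) ≤ c.1 i := by positivity
  have hb : (0 : ℝ) ≤ c.2 i := by positivity
  generalize (c.1 i : ℝ) = a at ha
  generalize (c.2 i : ℝ) = b at hb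
  have h4 : (1 + a) * (1 + b) * 4 ≤ (2 + a + b) ^ 2 := by nlinarith [sq_nonneg (a - b)]
  calc (a + b + 1) * ((1 + a) * (1 + b)) * 4 = (a + b + 1) * ((1 + a) * (1 + b) * 4) := by ring
    _ ≤ (a + b + 1) * (2 + a + b) ^ 2 := by gcongr
    _ ≤ 1 * ((2 + a + b) ^ 2 * (3 + a + b)) := by nlinarith [sq_nonneg (2 + a + b)]

section

variable {m : ℕ} {Θ : Type*} [MeasurableSpace Θ]


/-! ### Likelihood of the feedback of one round -/

/-- Increments of the success and failure counts in a round with triggered set `q.1` and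
coins `q.2`. -/
def increment (q : Finset (Fin m) × (Fin m → Bool)) : (Fin m → ℕ) × (Fin m → ℕ) :=
  (fun i => if i ∈ q.1 ∧ q.2 i = true then 1 else 0,
    fun i => if i ∈ q.1 ∧ q.2 i = false then 1 else 0)

lemma measurable_increment :
    Measurable (increment : Finset (Fin m) × (Fin m → Bool) → (Fin m → ℕ) × (Fin m → ℕ)) :=
  measurable_of_finite _

/-- Success and failure counts of all base arms in the history `h`. -/
def counts {t : ℕ} (h : Fin t → Round m) : (Fin m → ℕ) × (Fin m → ℕ) :=
  (count true h, count false h)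

lemma measurable_counts {t : ℕ} : Measurable (counts : (Fin t → Round m) → _) :=
  (measurable_count true).prodMk (measurable_count false)

lemma count_snoc {t : ℕ} (v : Bool) (h : Fin t → Round m) (ρ : Round m) (i : Fin m) :
    count v (Fin.snoc h ρ : Fin (t + 1) → Round m) i =
      count v h i + if i ∈ ρ.2.2.1 ∧ ρ.2.2.2 i = v then 1 else 0 := by
  simp only [count, Finset.card_filter, Fin.sum_univ_castSucc, Fin.snoc_castSucc, Fin.snoc_last]

lemma counts_snoc {t : ℕ} (h : Fin t → Round m) (ρ : Round m) :
    counts (Fin.snoc h ρ : Fin (t + 1) → Round m) = counts h + increment ρ.2.2 := by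
  ext i <;> simp [counts, increment, count_snoc]

/-- A triggered arm adds exactly one unit, to one of its two counts, so the increments reveal the
triggered set and its coins; the remaining coins stay free. -/
lemma increment_preimage (A : Finset (Fin m)) (z : Fin m → Bool) :
    increment ⁻¹' {increment (A, z)} =
      ({A} : Set (Finset (Fin m))) ×ˢ univ.pi fun i => if i ∈ A then {z i} else univ := by
  ext ⟨A', y⟩
  simp only [mem_preimage, mem_singleton_iff, mem_prod, mem_univ_pi, increment, Prod.mk.injEq,
    funext_iff]
  constructor
  · rintro ⟨h1, h2⟩
    have hA : A' = A := by
      ext i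
      have := h1 i
      have := h2 i
      cases hy : y i <;> cases hz : z i <;> by_cases h : i ∈ A <;> by_cases h' : i ∈ A' <;>
        simp_all
    subst hA
    refine ⟨rfl, fun i => ?_⟩
    have := h1 i
    have := h2 i
    cases hy : y i <;> cases hz : z i <;> by_cases h' : i ∈ A' <;> simp_all
  · rintro ⟨rfl, h⟩
    constructor <;> intro i <;> have := h i <;> by_cases h' : i ∈ A' <;> simp_all

lemma coin_singleton (x : ℝ) (hx : x ∈ Icc (0 : ℝ) 1) (b : Bool) :
    coin x {b} = if b then ENNReal.ofReal x else ENNReal.ofReal (1 - x) := by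
  have h : max 0 (min x 1) = x := by rw [min_eq_left hx.2, max_eq_right hx.1]
  cases b <;> simp [coin, h]

namespace Bandit

variable (𝓑 : Bandit m Θ)

lemma ae_mem_Icc (e : Θ) (i : Fin m) : ∀ᵐ x ∂(𝓑.outcome e), x i ∈ Icc (0 : ℝ) 1 :=
  (𝓑.outcome_mem e).mono fun _ hx => ⟨hx.1 i, hx.2 i⟩

lemma integrable_eval (e : Θ) (i : Fin m) : Integrable (fun x : Fin m → ℝ => x i) (𝓑.outcome e) :=
  Integrable.of_bound (measurable_pi_apply i).aestronglyMeasurable 1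
    ((𝓑.ae_mem_Icc e i).mono fun x hx => by
      rw [Real.norm_eq_abs, abs_le]; constructor <;> linarith [hx.1, hx.2])

lemma mean_mem_Icc (e : Θ) : 𝓑.mean e ∈ Icc (0 : Fin m → ℝ) 1 := by
  constructor
  · exact fun i => integral_nonneg_of_ae ((𝓑.ae_mem_Icc e i).mono fun x hx => hx.1)
  · intro i
    have := integral_mono_ae (𝓑.integrable_eval e i) (integrable_const (1 : ℝ))
      ((𝓑.ae_mem_Icc e i).mono fun x hx => hx.2)
    simpa [mean] using this

lemma measurable_mean : Measurable 𝓑.mean := by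
  refine measurable_pi_lambda _ fun i => ?_
  have : StronglyMeasurable fun e => ∫ x, x i ∂(𝓑.outcome e) :=
    (measurable_pi_apply i : Measurable fun x : Fin m → ℝ => x i).stronglyMeasurable.integral_kernel
  exact this.measurable

lemma lintegral_coin_singleton (e : Θ) (i : Fin m) (b : Bool) :
    ∫⁻ x, coin (x i) {b} ∂(𝓑.outcome e) =
      if b then ENNReal.ofReal (𝓑.mean e i) else ENNReal.ofReal (1 - 𝓑.mean e i) := by
  rw [lintegral_congr_ae ((𝓑.ae_mem_Icc e i).mono fun x hx => coin_singleton (x i) hx b)]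
  cases b
  · simp only [Bool.false_eq_true, if_false]
    have hi : Integrable (fun x : Fin m → ℝ => 1 - x i) (𝓑.outcome e) :=
      (integrable_const 1).sub (𝓑.integrable_eval e i)
    rw [← ofReal_integral_eq_lintegral_ofReal hi
      ((𝓑.ae_mem_Icc e i).mono fun x hx => sub_nonneg.2 hx.2), integral_sub (integrable_const 1)
      (𝓑.integrable_eval e i)]
    simp [mean]
  · simp only [if_true]
    rw [← ofReal_integral_eq_lintegral_ofReal (𝓑.integrable_eval e i)
      ((𝓑.ae_mem_Icc e i).mono fun x hx => hx.1)]
    rfl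

/-- The likelihood of the feedback of one round is, up to a factor that does not depend on the
environment, the likelihood of the coins of the triggered arms. -/
theorem exists_feedback_likelihood (hcascade : 𝓑.CascadeTriggering)
    (hindep : 𝓑.IndependentOutcomes) {S : Finset (Fin m)} (hS : S ∈ 𝓑.superArms)
    (d : (Fin m → ℕ) × (Fin m → ℕ)) :
    ∃ g : ENNReal, ∀ e, ∫⁻ x, ((𝓑.trig (S, x)).prod (coins m x)) (increment ⁻¹' {d})
      ∂(𝓑.outcome e) = g * likelihood d (𝓑.mean e) := by
  by_cases hd : ∃ q, increment q = d
  swap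
  · refine ⟨0, fun e => ?_⟩
    have : increment ⁻¹' {d} = (∅ : Set (Finset (Fin m) × (Fin m → Bool))) := by
      ext q
      simpa using fun h => hd ⟨q, h⟩
    simp [this]
  obtain ⟨⟨A, z⟩, rfl⟩ := hd
  -- A reference outcome vector read off the coins: a binary arm in `A` whose coin shows `z i` has
  -- outcome `x₀ i`. This makes the triggering factor below independent of the environment.
  let x₀ : Fin m → ℝ := fun i => if z i then 1 else 0
  have hx₀ : x₀ ∈ Icc (0 : Fin m → ℝ) 1 := by
    constructor <;> intro i <;> by_cases h : z i <;> simp [x₀, h]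
  let f : Fin m → ℝ → ENNReal := fun i y => if i ∈ A then coin y {z i} else 1
  have hf : ∀ i, Measurable (f i) := by
    intro i
    by_cases h : i ∈ A
    · simp only [f, if_pos h]
      exact (Measure.measurable_coe (measurableSet_singleton (z i))).comp measurable_coin
    · simp only [f, if_neg h, measurable_const]
  refine ⟨𝓑.trig (S, x₀) {A}, fun e => ?_⟩
  have hbin : ∀ᵐ x ∂(𝓑.outcome e), ∀ i, 𝓑.IsBinary i → x i = 0 ∨ x i = 1 := by
    rw [ae_all_iff]
    intro i
    by_cases h : 𝓑.IsBinary i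
    · exact (h e).mono fun x hx _ => hx
    · exact ae_of_all _ fun x h' => absurd h' h
  have hae : ∀ᵐ x ∂(𝓑.outcome e), ((𝓑.trig (S, x)).prod (coins m x))
      (increment ⁻¹' {increment (A, z)}) = 𝓑.trig (S, x₀) {A} * ∏ i, f i (x i) := by
    filter_upwards [hbin, 𝓑.outcome_mem e] with x hxb hx
    have hcoins : coins m x (univ.pi fun i => if i ∈ A then {z i} else univ) =
        ∏ i, f i (x i) := by
      change Measure.pi (fun i => coin (x i)) _ = _
      rw [Measure.pi_pi]
      refine Finset.prod_congr rfl fun i _ => ?_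
      by_cases h : i ∈ A
      · simp [f, h]
      · simp only [f, if_neg h, measure_univ]
    rw [increment_preimage, Measure.prod_prod, hcoins]
    -- Either the coins are impossible under `x` and both sides vanish, or every binary arm in `A`
    -- satisfies `x i = x₀ i` and cascade triggering applies.
    by_cases h0 : ∏ i, f i (x i) = 0
    · rw [h0, mul_zero, mul_zero]
    · rw [hcascade S hS A x hx x₀ hx₀]
      intro i hiA hib
      have hne := (Finset.prod_ne_zero_iff.1 h0) i (Finset.mem_univ i)
      simp only [f, if_pos hiA] at hne
      rw [coin_singleton (x i) ⟨hx.1 i, hx.2 i⟩] at hne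
      rcases hxb i hib with h | h <;> cases hz : z i <;> simp_all [x₀]
  have hprod : Measurable fun x : Fin m → ℝ => ∏ i, f i (x i) :=
    Finset.measurable_prod _ fun i _ => (hf i).comp (measurable_pi_apply i)
  rw [lintegral_congr_ae hae, lintegral_const_mul _ hprod]
  congr 1
  have hind : iIndepFun (fun i (x : Fin m → ℝ) => f i (x i)) (𝓑.outcome e) :=
    (hindep e).comp f hf
  rw [lintegral_prod_eq_prod_lintegral_of_indepFun Finset.univ _ hind
    (fun i => (hf i).comp (measurable_pi_apply i)), likelihood]
  refine Finset.prod_congr rfl fun i _ => ?_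
  by_cases h : i ∈ A
  · simp only [f, if_pos h, 𝓑.lintegral_coin_singleton, coinLikelihood, increment]
    by_cases hz : z i = true <;> simp [h, hz]
  · simp [f, h, increment, coinLikelihood]

end Bandit

/-! ### Likelihood of the history -/

variable (𝓑 : Bandit m Θ) {oracle : (Fin m → ℝ) → Finset (Fin m)} (ho : Measurable oracle)

lemma lintegral_roundKernel (t : ℕ) (e : Θ) (h : Fin t → Round m) (f : Round m → ENNReal)
    (hf : Measurable f) :
    ∫⁻ ρ, f ρ ∂(roundKernel 𝓑 ho t (e, h)) =
      ∫⁻ θ, ∫⁻ x, ∫⁻ q, f (θ, x, q) ∂((𝓑.trig (oracle θ, x)).prod (coins m x))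
        ∂(𝓑.outcome e) ∂(betaSample m (counts h)) := by
  rw [roundKernel, Kernel.lintegral_compProd _ _ _ hf]
  refine lintegral_congr fun θ => ?_
  rw [Kernel.lintegral_compProd _ _ _ (by fun_prop)]
  simp only [Kernel.comap_apply, Kernel.prod_apply]

lemma ae_betaSample_mem_Icc (c : (Fin m → ℕ) × (Fin m → ℕ)) :
    ∀ᵐ x ∂(betaSample m c), x ∈ Icc (0 : Fin m → ℝ) 1 := by
  have h := betaSample_absolutelyContinuous c
  rw [cubeUniform_eq] at h
  exact h.ae_le (ae_restrict_mem measurableSet_Icc)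

/-- Given the counts, the law of `θ`, hence of the super arm played, does not involve the
environment; averaging the one-round factor over `θ` keeps it environment-free. -/
lemma exists_round_likelihood (hcascade : 𝓑.CascadeTriggering) (hindep : 𝓑.IndependentOutcomes)
    (horacle : ∀ θ ∈ Icc (0 : Fin m → ℝ) 1, oracle θ ∈ 𝓑.superArms) (t : ℕ) :
    ∃ G : (Fin m → ℕ) × (Fin m → ℕ) → (Fin m → ℕ) × (Fin m → ℕ) → ENNReal,
      ∀ e (h : Fin t → Round m) d,
        roundKernel 𝓑 ho t (e, h) {ρ | increment ρ.2.2 = d} =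
          G (counts h) d * likelihood d (𝓑.mean e) := by
  have hg : ∀ S d, ∃ g : ENNReal, S ∈ 𝓑.superArms → ∀ e,
      ∫⁻ x, ((𝓑.trig (S, x)).prod (coins m x)) (increment ⁻¹' {d})
        ∂(𝓑.outcome e) = g * likelihood d (𝓑.mean e) := by
    intro S d
    by_cases hS : S ∈ 𝓑.superArms
    · obtain ⟨g, hg⟩ := 𝓑.exists_feedback_likelihood hcascade hindep hS d
      exact ⟨g, fun _ => hg⟩
    · exact ⟨0, fun h => absurd h hS⟩
  choose g hg using hg
  refine ⟨fun c d => ∫⁻ θ, g (oracle θ) d ∂(betaSample m c), fun e h d => ?_⟩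
  have hs : MeasurableSet {ρ : Round m | increment ρ.2.2 = d} :=
    (measurable_increment.comp (measurable_snd.comp measurable_snd)) (measurableSet_singleton d)
  rw [← lintegral_indicator_one hs,
    lintegral_roundKernel 𝓑 ho t e h _ (measurable_one.indicator hs), ← lintegral_mul_const]
  · refine lintegral_congr_ae ((ae_betaSample_mem_Icc _).mono fun θ hθ => ?_)
    simp only
    rw [← hg (oracle θ) d (horacle θ hθ) e]
    refine lintegral_congr fun x => ?_
    rw [← lintegral_indicator_one (measurable_increment (measurableSet_singleton d))]
    rfl
  · exact (measurable_of_finite fun S => g S d).comp ho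

lemma lintegral_historyKernel_succ (t : ℕ) (e : Θ) (f : (Fin (t + 1) → Round m) → ENNReal)
    (hf : Measurable f) :
    ∫⁻ h, f h ∂(historyKernel 𝓑 ho (t + 1) e) =
      ∫⁻ h, ∫⁻ ρ, f (Fin.snoc h ρ) ∂(roundKernel 𝓑 ho t (e, h)) ∂(historyKernel 𝓑 ho t e) := by
  have hfs : Measurable fun q : (Fin t → Round m) × Round m =>
      f (Fin.snoc q.1 q.2 : Fin (t + 1) → Round m) := hf.comp (measurable_snoc m t)
  rw [historyKernel, Kernel.map_apply _ (measurable_snoc m t),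
    lintegral_map hf (measurable_snoc m t), Kernel.lintegral_compProd _ _ _ hfs]

/-- The likelihood of the counts after `t` rounds is, up to a factor that does not depend on the
environment, the likelihood of independent coins. -/
theorem exists_history_likelihood (hcascade : 𝓑.CascadeTriggering)
    (hindep : 𝓑.IndependentOutcomes)
    (horacle : ∀ θ ∈ Icc (0 : Fin m → ℝ) 1, oracle θ ∈ 𝓑.superArms) (t : ℕ) :
    ∃ K : (Fin m → ℕ) × (Fin m → ℕ) → ENNReal, ∀ e c,
      (historyKernel 𝓑 ho t e).map counts {c} = K c * likelihood c (𝓑.mean e) := by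
  induction t with
  | zero =>
    refine ⟨fun c => if c = 0 then 1 else 0, fun e c => ?_⟩
    rw [Measure.map_apply measurable_counts (measurableSet_singleton c), historyKernel,
      Kernel.const_apply, Measure.dirac_apply' _ (measurable_counts (measurableSet_singleton c))]
    have h0 : counts (Fin.elim0 : Fin 0 → Round m) = 0 := by
      ext i <;> simp [counts, count]
    by_cases hc : c = 0
    · subst hc
      simp [h0, likelihood_zero]
    · simp [h0, hc, Ne.symm hc]
  | succ t ih =>
    obtain ⟨K, hK⟩ := ih
    obtain ⟨G, hG⟩ := exists_round_likelihood 𝓑 ho hcascade hindep horacle t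
    -- The factors convolve over all splittings of `c` into past counts and an increment, because
    -- the likelihood is multiplicative in the counts.
    refine ⟨fun c => ∑' c', ∑' d, if c' + d = c then K c' * G c' d else 0, fun e c => ?_⟩
    have hmi : Measurable fun ρ : Round m => increment ρ.2.2 :=
      measurable_increment.comp (measurable_snd.comp measurable_snd)
    have hs := measurableSet_singleton c
    have hstep : ∀ h : Fin t → Round m,
        ∫⁻ ρ, ({c} : Set _).indicator 1 (counts (Fin.snoc h ρ : Fin (t + 1) → Round m))
          ∂(roundKernel 𝓑 ho t (e, h)) =
        ∑' d, if counts h + d = c then G (counts h) d * likelihood d (𝓑.mean e) else 0 := by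
      intro h
      simp only [counts_snoc]
      rw [← lintegral_map (f := fun d => ({c} : Set ((Fin m → ℕ) × (Fin m → ℕ))).indicator
          (1 : (Fin m → ℕ) × (Fin m → ℕ) → ENNReal) (counts h + d))
        (measurable_of_countable _) hmi, lintegral_countable']
      refine tsum_congr fun d => ?_
      rw [Measure.map_apply hmi (measurableSet_singleton d)]
      have := hG e h d
      by_cases hd : counts h + d = c
      · rw [if_pos hd, ← this, hd]
        simp [preimage]
      · simp [hd]
    have hmf : Measurable fun h : Fin (t + 1) → Round m =>
        ({c} : Set ((Fin m → ℕ) × (Fin m → ℕ))).indicator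
          (1 : (Fin m → ℕ) × (Fin m → ℕ) → ENNReal) (counts h) :=
      (measurable_one.indicator hs).comp measurable_counts
    rw [← lintegral_indicator_one hs, lintegral_map (measurable_one.indicator hs) measurable_counts,
      lintegral_historyKernel_succ 𝓑 ho t e _ hmf]
    simp only [hstep]
    rw [← lintegral_map (f := fun c' => ∑' d, if c' + d = c then
      G c' d * likelihood d (𝓑.mean e) else 0) (measurable_of_countable _) measurable_counts,
      lintegral_countable', ← ENNReal.tsum_mul_right]
    refine tsum_congr fun c' => ?_
    rw [hK, ← ENNReal.tsum_mul_right, ← ENNReal.tsum_mul_right]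
    refine tsum_congr fun d => ?_
    by_cases hd : c' + d = c
    · rw [if_pos hd, if_pos hd, ← hd, likelihood_add]
      ring
    · rw [if_neg hd, if_neg hd, zero_mul, zero_mul]

/-! ### The posterior of the mean vector -/

instance bayesLaw_isProb (prior : Measure Θ) [IsProbabilityMeasure prior] (t : ℕ) :
    IsProbabilityMeasure (bayesLaw 𝓑 ho prior t) := by
  unfold bayesLaw; infer_instance

/-- Given the counts, the mean vector is distributed as the parameter vector sampled by the
algorithm. -/
theorem lintegral_posterior (hcascade : 𝓑.CascadeTriggering) (hindep : 𝓑.IndependentOutcomes)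
    (horacle : ∀ θ ∈ Icc (0 : Fin m → ℝ) 1, oracle θ ∈ 𝓑.superArms)
    (prior : Measure Θ) [IsProbabilityMeasure prior] (hprior : 𝓑.UniformMeanPrior prior) (t : ℕ)
    (f : (Fin m → ℝ) → (Fin m → ℕ) × (Fin m → ℕ) → ENNReal) (hf : ∀ c, Measurable fun x => f x c) :
    ∫⁻ ω, f (𝓑.mean ω.1) (counts ω.2) ∂(bayesLaw 𝓑 ho prior t) =
      ∫⁻ ω, ∫⁻ x, f x (counts ω.2) ∂(betaSample m (counts ω.2)) ∂(bayesLaw 𝓑 ho prior t) := by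
  obtain ⟨K, hK⟩ := exists_history_likelihood 𝓑 ho hcascade hindep horacle t
  have hmc : Measurable fun ω : Θ × (Fin t → Round m) => counts ω.2 :=
    measurable_counts.comp measurable_snd
  have hmm : Measurable fun ω : Θ × (Fin t → Round m) => 𝓑.mean ω.1 :=
    𝓑.measurable_mean.comp measurable_fst
  -- This formula sees `F` only through its posterior averages. Replacing `f` by its posterior
  -- average changes none of them, so the two sides of the theorem agree.
  have key : ∀ F : (Fin m → ℝ) → (Fin m → ℕ) × (Fin m → ℕ) → ENNReal,
      (∀ c, Measurable fun x => F x c) →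
      ∫⁻ ω, F (𝓑.mean ω.1) (counts ω.2) ∂(bayesLaw 𝓑 ho prior t) =
        ∑' c, K c * (evidence c * ∫⁻ x, F x c ∂(betaSample m c)) := by
    intro F hF
    have hFj : Measurable fun p : (Fin m → ℝ) × ((Fin m → ℕ) × (Fin m → ℕ)) => F p.1 p.2 :=
      measurable_from_prod_countable_left hF
    have hFω : Measurable fun ω : Θ × (Fin t → Round m) => F (𝓑.mean ω.1) (counts ω.2) :=
      hFj.comp (hmm.prodMk hmc)
    rw [bayesLaw, Measure.lintegral_compProd hFω]
    have hin : ∀ e, ∫⁻ h, F (𝓑.mean e) (counts h) ∂(historyKernel 𝓑 ho t e) =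
        ∑' c, K c * (F (𝓑.mean e) c * likelihood c (𝓑.mean e)) := by
      intro e
      rw [← lintegral_map (f := fun c => F (𝓑.mean e) c) (measurable_of_countable _)
        measurable_counts, lintegral_countable']
      refine tsum_congr fun c => ?_
      rw [hK]
      ring
    have hmF : ∀ c, Measurable fun x => F x c * likelihood c x :=
      fun c => (hF c).mul (measurable_likelihood c)
    simp only [hin]
    have hmFe : ∀ c, Measurable fun e => F (𝓑.mean e) c * likelihood c (𝓑.mean e) :=
      fun c => (hmF c).comp 𝓑.measurable_mean
    rw [lintegral_tsum fun c => ((hmFe c).const_mul _).aemeasurable]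
    refine tsum_congr fun c => ?_
    rw [← lintegral_mul_likelihood c _ (hF c), cubeUniform_eq, ← hprior,
      lintegral_map (hmF c) 𝓑.measurable_mean,
      lintegral_const_mul _ (hmFe c)]
  rw [key f hf, key (fun _ c => ∫⁻ x, f x c ∂(betaSample m c)) fun c => measurable_const]
  refine tsum_congr fun c => ?_
  rw [lintegral_const, measure_univ, mul_one]

end

section

variable {m : ℕ} {Θ : Type*} [MeasurableSpace Θ]


/-! ### Extension of the expected reward to the whole cube -/

namespace Bandit

variable (𝓑 : Bandit m Θ)

instance feedback_isProb (e : Θ) (S : Finset (Fin m)) : IsProbabilityMeasure (𝓑.feedback e S) := by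
  unfold feedback; infer_instance

lemma trigProb_nonneg (e : Θ) (S : Finset (Fin m)) (i : Fin m) : 0 ≤ 𝓑.trigProb e S i :=
  measureReal_nonneg

lemma trigProb_le_one (e : Θ) (S : Finset (Fin m)) (i : Fin m) : 𝓑.trigProb e S i ≤ 1 :=
  measureReal_le_one

lemma ofReal_trigProb (e : Θ) (S : Finset (Fin m)) (i : Fin m) :
    ENNReal.ofReal (𝓑.trigProb e S i) = ∫⁻ x, 𝓑.trig (S, x) {A | i ∈ A} ∂(𝓑.outcome e) := by
  have hs : MeasurableSet {q : (Fin m → ℝ) × Finset (Fin m) | i ∈ q.2} :=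
    measurable_snd (Set.toFinite {A : Finset (Fin m) | i ∈ A}).measurableSet
  rw [trigProb, ofReal_measureReal, feedback, Measure.compProd_apply hs]
  simp [Kernel.sectR_apply, preimage]

lemma measurable_trigProb (i : Fin m) :
    Measurable fun p : Θ × Finset (Fin m) => 𝓑.trigProb p.1 p.2 i := by
  refine measurable_from_prod_countable_left fun S => ?_
  have h : ∀ e, 𝓑.trigProb e S i =
      (∫⁻ x, 𝓑.trig (S, x) {A | i ∈ A} ∂(𝓑.outcome e)).toReal := fun e => by
    rw [← ofReal_trigProb, ENNReal.toReal_ofReal (𝓑.trigProb_nonneg e S i)]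
  simp only [h]
  have hm : Measurable fun x => 𝓑.trig (S, x) {A | i ∈ A} :=
    (𝓑.trig.measurable_coe (Set.toFinite {A : Finset (Fin m) | i ∈ A}).measurableSet).comp
      measurable_prodMk_left
  exact hm.lintegral_kernel.ennreal_toReal

lemma TPMLipschitz.abs_sub_le {𝓑 : Bandit m Θ} {r : Finset (Fin m) → (Fin m → ℝ) → ℝ} {B : ℝ}
    (hlip : 𝓑.TPMLipschitz r B) {S : Finset (Fin m)} (hS : S ∈ 𝓑.superArms) (e e' : Θ) :
    |r S (𝓑.mean e) - r S (𝓑.mean e')| ≤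
      B * ∑ i, 𝓑.trigProb e S i * |𝓑.mean e i - 𝓑.mean e' i| := by
  refine (hlip S hS e e').trans_eq ?_
  congr 1
  rw [trigSet, Finset.sum_filter]
  refine Finset.sum_congr rfl fun i _ => ?_
  split_ifs with h
  · rfl
  · rw [le_antisymm (not_lt.1 h) (𝓑.trigProb_nonneg e S i), zero_mul]

/-- Bounding triggering probabilities by 1 makes `r S` Lipschitz with constant `B * m` in the sup
distance on the set of mean vectors; a real-valued Lipschitz function extends to the whole space. -/
lemma TPMLipschitz.exists_continuous_extension {𝓑 : Bandit m Θ}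
    {r : Finset (Fin m) → (Fin m → ℝ) → ℝ} {B : ℝ} (hB : 0 < B) (hlip : 𝓑.TPMLipschitz r B) :
    ∃ g : Finset (Fin m) → (Fin m → ℝ) → ℝ, (∀ S, Continuous (g S)) ∧
      ∀ S ∈ 𝓑.superArms, ∀ e, g S (𝓑.mean e) = r S (𝓑.mean e) := by
  have h : ∀ S, ∃ f : (Fin m → ℝ) → ℝ, Continuous f ∧
      (S ∈ 𝓑.superArms → ∀ e, f (𝓑.mean e) = r S (𝓑.mean e)) := by
    intro S
    by_cases hS : S ∈ 𝓑.superArms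
    swap
    · exact ⟨0, continuous_zero, fun h => absurd h hS⟩
    have hL : LipschitzOnWith (Real.toNNReal (B * m)) (r S) (range 𝓑.mean) := by
      refine LipschitzOnWith.of_dist_le_mul ?_
      rintro _ ⟨e, rfl⟩ _ ⟨e', rfl⟩
      rw [Real.dist_eq, Real.coe_toNNReal _ (by positivity)]
      refine (hlip.abs_sub_le hS e e').trans ?_
      rw [mul_assoc]
      gcongr
      calc ∑ i, 𝓑.trigProb e S i * |𝓑.mean e i - 𝓑.mean e' i|
          ≤ ∑ _i : Fin m, dist (𝓑.mean e) (𝓑.mean e') := by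
            refine Finset.sum_le_sum fun i _ => ?_
            refine (mul_le_of_le_one_left (abs_nonneg _) (𝓑.trigProb_le_one e S i)).trans ?_
            rw [← Real.dist_eq]
            exact dist_le_pi_dist _ _ i
        _ = m * dist (𝓑.mean e) (𝓑.mean e') := by simp
    obtain ⟨f, hf, hfe⟩ := hL.extend_real
    exact ⟨f, hf.continuous, fun _ e => (hfe ⟨e, rfl⟩).symm⟩
  choose g hg hge using h
  exact ⟨g, hg, hge⟩

/-- The triggering probabilities are those of the fixed `e`, so both sides are continuous in `θ` and
the inequality passes to the closure. -/
lemma TPMLipschitz.abs_sub_le_of_mem_closure {𝓑 : Bandit m Θ}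
    {r g : Finset (Fin m) → (Fin m → ℝ) → ℝ} {B : ℝ} (hlip : 𝓑.TPMLipschitz r B)
    (hg : ∀ S, Continuous (g S)) (hgr : ∀ S ∈ 𝓑.superArms, ∀ e, g S (𝓑.mean e) = r S (𝓑.mean e))
    {S : Finset (Fin m)} (hS : S ∈ 𝓑.superArms) (e : Θ) {θ : Fin m → ℝ}
    (hθ : θ ∈ closure (range 𝓑.mean)) :
    |g S (𝓑.mean e) - g S θ| ≤ B * ∑ i, 𝓑.trigProb e S i * |𝓑.mean e i - θ i| := by
  have hc : IsClosed {θ : Fin m → ℝ | |g S (𝓑.mean e) - g S θ| ≤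
      B * ∑ i, 𝓑.trigProb e S i * |𝓑.mean e i - θ i|} := by
    have := hg S
    exact isClosed_le (by fun_prop) (by fun_prop)
  refine closure_minimal ?_ hc hθ
  rintro _ ⟨e', rfl⟩
  rw [mem_ofPred_eq, hgr S hS, hgr S hS]
  exact hlip.abs_sub_le hS e e'

/-- Largest value of `g` over the feasible super arms. -/
noncomputable def maxReward (g : Finset (Fin m) → (Fin m → ℝ) → ℝ) (θ : Fin m → ℝ) : ℝ :=
  𝓑.superArms.sup' 𝓑.superArms_nonempty fun S => g S θ

lemma continuous_maxReward {g : Finset (Fin m) → (Fin m → ℝ) → ℝ} (hg : ∀ S, Continuous (g S)) :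
    Continuous (𝓑.maxReward g) :=
  Continuous.finset_sup'_apply _ fun S _ => hg S

lemma gap_eq {r g : Finset (Fin m) → (Fin m → ℝ) → ℝ}
    (hgr : ∀ S ∈ 𝓑.superArms, ∀ e, g S (𝓑.mean e) = r S (𝓑.mean e)) {S : Finset (Fin m)}
    (hS : S ∈ 𝓑.superArms) (e : Θ) :
    𝓑.gap r e S = 𝓑.maxReward g (𝓑.mean e) - g S (𝓑.mean e) := by
  rw [gap, maxReward, hgr S hS]
  congr 1
  exact Finset.sup'_congr _ rfl fun S' hS' => (hgr S' hS' e).symm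

/-- Transfers facts from mean vectors to sampled parameters, without requiring the set of mean
vectors itself to be measurable or the whole cube. -/
lemma ae_cubeUniform_of_forall_mean {prior : Measure Θ} [IsProbabilityMeasure prior]
    (hprior : 𝓑.UniformMeanPrior prior) {s : Set (Fin m → ℝ)} (hs : MeasurableSet s)
    (h : ∀ e, 𝓑.mean e ∈ s) : ∀ᵐ θ ∂(cubeUniform m), θ ∈ s := by
  rw [cubeUniform_eq, ← hprior]
  refine (ae_map_iff 𝓑.measurable_mean.aemeasurable hs).2 ?_
  exact ae_of_all _ h

/-- For almost every parameter vector, the oracle maximizes any continuous extension of the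
expected reward. -/
lemma ae_oracle_optimal {r g : Finset (Fin m) → (Fin m → ℝ) → ℝ} (hg : ∀ S, Continuous (g S))
    (hgr : ∀ S ∈ 𝓑.superArms, ∀ e, g S (𝓑.mean e) = r S (𝓑.mean e))
    {prior : Measure Θ} [IsProbabilityMeasure prior] (hprior : 𝓑.UniformMeanPrior prior)
    {oracle : (Fin m → ℝ) → Finset (Fin m)} (ho : Measurable oracle)
    (hexact : 𝓑.IsExactOracle r oracle) :
    ∀ᵐ θ ∂(cubeUniform m), 𝓑.maxReward g θ = g (oracle θ) θ := by
  have hm : Measurable fun θ => g (oracle θ) θ := by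
    have : Measurable fun p : (Fin m → ℝ) × Finset (Fin m) => g p.2 p.1 :=
      measurable_from_prod_countable_left fun S => (hg S).measurable
    exact this.comp (measurable_id.prodMk ho)
  refine 𝓑.ae_cubeUniform_of_forall_mean hprior
    (measurableSet_eq_fun (𝓑.continuous_maxReward hg).measurable hm) fun e => ?_
  obtain ⟨h1, h2⟩ := hexact _ (𝓑.mean_mem_Icc e)
  refine le_antisymm (Finset.sup'_le _ _ fun S hS => ?_)
    (Finset.le_sup' (fun S => g S (𝓑.mean e)) h1)
  rw [hgr S hS, hgr _ h1]
  exact h2 S hS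

end Bandit

lemma exists_forall_abs_le {g : Finset (Fin m) → (Fin m → ℝ) → ℝ} (hg : ∀ S, Continuous (g S)) :
    ∃ C, ∀ S, ∀ θ ∈ Icc (0 : Fin m → ℝ) 1, |g S θ| ≤ C := by
  have h : ∀ S, ∃ C, ∀ θ ∈ Icc (0 : Fin m → ℝ) 1, ‖g S θ‖ ≤ C :=
    fun S => isCompact_Icc.exists_bound_of_continuousOn (hg S).continuousOn
  choose C hC using h
  refine ⟨∑ S, C S, fun S θ hθ => (hC S θ hθ).trans
    (Finset.single_le_sum (fun S _ => (norm_nonneg _).trans (hC S θ hθ)) (Finset.mem_univ S))⟩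

lemma abs_maxReward_le (𝓑 : Bandit m Θ) {g : Finset (Fin m) → (Fin m → ℝ) → ℝ} {C : ℝ}
    {θ : Fin m → ℝ} (h : ∀ S, |g S θ| ≤ C) : |𝓑.maxReward g θ| ≤ C := by
  obtain ⟨S, _, hS⟩ := Finset.exists_mem_eq_sup' 𝓑.superArms_nonempty fun S => g S θ
  rw [Bandit.maxReward, hS]
  exact h S

/-! ### One more round -/

/-- Joint law of the environment, the first `t` rounds, and the next round. -/
noncomputable def stepLaw (𝓑 : Bandit m Θ) {oracle : (Fin m → ℝ) → Finset (Fin m)}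
    (ho : Measurable oracle) (prior : Measure Θ) (t : ℕ) :
    Measure ((Θ × (Fin t → Round m)) × Round m) :=
  bayesLaw 𝓑 ho prior t ⊗ₘ roundKernel 𝓑 ho t

variable (𝓑 : Bandit m Θ) {oracle : (Fin m → ℝ) → Finset (Fin m)} (ho : Measurable oracle)
  (prior : Measure Θ) [IsProbabilityMeasure prior]

instance stepLaw_isProb (t : ℕ) : IsProbabilityMeasure (stepLaw 𝓑 ho prior t) := by
  unfold stepLaw; infer_instance

lemma measurePreserving_fst_stepLaw (t : ℕ) :
    MeasurePreserving Prod.fst (stepLaw 𝓑 ho prior t) (bayesLaw 𝓑 ho prior t) :=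
  ⟨measurable_fst, Measure.fst_compProd _ _⟩

/-- Allows induction on the horizon: quantities after `t + 1` rounds are computed with the past and
the new round kept apart. -/
lemma measurePreserving_snoc_stepLaw (t : ℕ) :
    MeasurePreserving (fun w : (Θ × (Fin t → Round m)) × Round m =>
      (w.1.1, (Fin.snoc w.1.2 w.2 : Fin (t + 1) → Round m)))
      (stepLaw 𝓑 ho prior t) (bayesLaw 𝓑 ho prior (t + 1)) := by
  have hm : Measurable fun w : (Θ × (Fin t → Round m)) × Round m =>
      (w.1.1, (Fin.snoc w.1.2 w.2 : Fin (t + 1) → Round m)) :=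
    (measurable_fst.comp measurable_fst).prodMk
      ((measurable_snoc m t).comp ((measurable_snd.comp measurable_fst).prodMk measurable_snd))
  refine ⟨hm, Measure.ext_of_lintegral _ fun f hf => ?_⟩
  have hf' : Measurable fun w : (Θ × (Fin t → Round m)) × Round m =>
      f (w.1.1, (Fin.snoc w.1.2 w.2 : Fin (t + 1) → Round m)) := hf.comp hm
  rw [lintegral_map hf hm, stepLaw, Measure.lintegral_compProd hf', bayesLaw,
    Measure.lintegral_compProd hf'.lintegral_kernel_prod_right', bayesLaw,
    Measure.lintegral_compProd hf]
  refine lintegral_congr fun e => ?_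
  exact (lintegral_historyKernel_succ 𝓑 ho t e _ (hf.comp measurable_prodMk_left)).symm

lemma lintegral_stepLaw_sample (t : ℕ)
    (f : (Θ × (Fin t → Round m)) × (Fin m → ℝ) → ENNReal) (hf : Measurable f) :
    ∫⁻ w, f (w.1, w.2.1) ∂(stepLaw 𝓑 ho prior t) =
      ∫⁻ ω, ∫⁻ θ, f (ω, θ) ∂(betaSample m (counts ω.2)) ∂(bayesLaw 𝓑 ho prior t) := by
  have hf' : Measurable fun w : (Θ × (Fin t → Round m)) × Round m => f (w.1, w.2.1) := by fun_prop
  rw [stepLaw, Measure.lintegral_compProd hf']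
  refine lintegral_congr fun ω => ?_
  refine (lintegral_roundKernel 𝓑 ho t ω.1 ω.2 (fun ρ => f (ω, ρ.1))
    (hf'.comp measurable_prodMk_left)).trans ?_
  simp

/-- Tower property: given the environment, the past and `θ`, arm `i` is triggered with probability
`trigProb`, while `φ` depends on the past alone. -/
lemma lintegral_stepLaw_trigProb (t : ℕ) (i : Fin m)
    (φ : (Fin t → Round m) → ENNReal) (hφ : Measurable φ) :
    ∫⁻ w, φ w.1.2 * ENNReal.ofReal (𝓑.trigProb w.1.1 (oracle w.2.1) i)
        ∂(stepLaw 𝓑 ho prior t) =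
      ∫⁻ w, φ w.1.2 * {A : Finset (Fin m) | i ∈ A}.indicator 1 w.2.2.2.1
        ∂(stepLaw 𝓑 ho prior t) := by
  have hs : MeasurableSet {A : Finset (Fin m) | i ∈ A} := (Set.toFinite _).measurableSet
  have hind : Measurable fun ρ : Round m =>
      {A : Finset (Fin m) | i ∈ A}.indicator (1 : Finset (Fin m) → ENNReal) ρ.2.2.1 :=
    (measurable_one.indicator hs).comp (by fun_prop)
  have hp := 𝓑.measurable_trigProb i
  have h1 : Measurable fun w : (Θ × (Fin t → Round m)) × (Fin m → ℝ) =>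
      φ w.1.2 * ENNReal.ofReal (𝓑.trigProb w.1.1 (oracle w.2) i) :=
    (hφ.comp (by fun_prop)).mul (hp.comp (by fun_prop : Measurable
      fun w : (Θ × (Fin t → Round m)) × (Fin m → ℝ) => (w.1.1, oracle w.2))).ennreal_ofReal
  have h2 : Measurable fun w : (Θ × (Fin t → Round m)) × Round m =>
      φ w.1.2 * {A : Finset (Fin m) | i ∈ A}.indicator 1 w.2.2.2.1 :=
    (hφ.comp (by fun_prop)).mul (hind.comp measurable_snd)
  rw [lintegral_stepLaw_sample 𝓑 ho prior t _ h1, stepLaw, Measure.lintegral_compProd h2]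
  refine lintegral_congr fun ω => ?_
  refine Eq.trans ?_ (lintegral_roundKernel 𝓑 ho t ω.1 ω.2 (fun ρ =>
    φ ω.2 * {A : Finset (Fin m) | i ∈ A}.indicator 1 ρ.2.2.1)
    (h2.comp measurable_prodMk_left)).symm
  refine lintegral_congr fun θ => ?_
  rw [𝓑.ofReal_trigProb, ← lintegral_const_mul]
  · refine lintegral_congr fun x => ?_
    rw [lintegral_const_mul _ (by exact (measurable_one.indicator hs).comp measurable_fst)]
    congr 1
    rw [lintegral_prod _ (by exact ((measurable_one.indicator hs).comp measurable_fst).aemeasurable)]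
    simp [lintegral_indicator_one hs]
  · exact (𝓑.trig.measurable_coe hs).comp measurable_prodMk_left

end

/-! ### Pull counts: posterior deviation and harmonic charging. -/

section

variable {m : ℕ} {Θ : Type*} [MeasurableSpace Θ]


/-- Number of past rounds in which the base arm `i` was triggered. -/
def pulls {t : ℕ} (h : Fin t → Round m) (i : Fin m) : ℕ := (counts h).1 i + (counts h).2 i

lemma measurable_pulls {t : ℕ} (i : Fin m) :
    Measurable fun h : Fin t → Round m => pulls h i :=
  (measurable_of_countable fun c : (Fin m → ℕ) × (Fin m → ℕ) => c.1 i + c.2 i).comp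
    measurable_counts

lemma pulls_snoc {t : ℕ} (h : Fin t → Round m) (ρ : Round m) (i : Fin m) :
    pulls (Fin.snoc h ρ : Fin (t + 1) → Round m) i =
      pulls h i + if i ∈ ρ.2.2.1 then 1 else 0 := by
  simp only [pulls, counts_snoc, increment, Prod.fst_add, Prod.snd_add, Pi.add_apply]
  by_cases hi : i ∈ ρ.2.2.1 <;> cases hb : ρ.2.2.2 i <;> simp [hi] <;> ring

lemma pulls_le {t : ℕ} (h : Fin t → Round m) (i : Fin m) : pulls h i ≤ t := by
  simp only [pulls, counts, count, Finset.card_filter, ← Finset.sum_add_distrib]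
  refine (Finset.sum_le_card_nsmul _ _ 1 fun s _ => ?_).trans (by simp)
  cases (h s).2.2.2 i <;> split_ifs <;> simp_all

variable (𝓑 : Bandit m Θ) {oracle : (Fin m → ℝ) → Finset (Fin m)} (ho : Measurable oracle)
  (prior : Measure Θ) [IsProbabilityMeasure prior]

lemma measurePreserving_mean_stepLaw (hprior : 𝓑.UniformMeanPrior prior) (t : ℕ) :
    MeasurePreserving (fun w : (Θ × (Fin t → Round m)) × Round m => 𝓑.mean w.1.1)
      (stepLaw 𝓑 ho prior t) (cubeUniform m) := by
  have h1 : MeasurePreserving Prod.fst (bayesLaw 𝓑 ho prior t) prior :=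
    ⟨measurable_fst, Measure.fst_compProd _ _⟩
  have h2 : MeasurePreserving 𝓑.mean prior (cubeUniform m) :=
    ⟨𝓑.measurable_mean, by rw [cubeUniform_eq]; exact hprior⟩
  exact h2.comp (h1.comp (measurePreserving_fst_stepLaw 𝓑 ho prior t))

lemma measurable_comp_counts {α : Type*} [MeasurableSpace α] {t : ℕ}
    (f : (Fin m → ℝ) → (Fin m → ℕ) × (Fin m → ℕ) → ENNReal) (hf : ∀ c, Measurable fun x => f x c)
    {X : α → Fin m → ℝ} (hX : Measurable X) {H : α → Fin t → Round m} (hH : Measurable H) :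
    Measurable fun a => f (X a) (counts (H a)) :=
  (measurable_from_prod_countable_left hf :
    Measurable fun p : (Fin m → ℝ) × ((Fin m → ℕ) × (Fin m → ℕ)) => f p.1 p.2).comp
      (hX.prodMk (measurable_counts.comp hH))

lemma lintegral_stepLaw_mean (hcascade : 𝓑.CascadeTriggering) (hindep : 𝓑.IndependentOutcomes)
    (horacle : ∀ θ ∈ Icc (0 : Fin m → ℝ) 1, oracle θ ∈ 𝓑.superArms)
    (hprior : 𝓑.UniformMeanPrior prior) (t : ℕ)
    (f : (Fin m → ℝ) → (Fin m → ℕ) × (Fin m → ℕ) → ENNReal) (hf : ∀ c, Measurable fun x => f x c) :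
    ∫⁻ w, f (𝓑.mean w.1.1) (counts w.1.2) ∂(stepLaw 𝓑 ho prior t) =
      ∫⁻ w, f w.2.1 (counts w.1.2) ∂(stepLaw 𝓑 ho prior t) := by
  have h1 : Measurable fun ω : Θ × (Fin t → Round m) => f (𝓑.mean ω.1) (counts ω.2) :=
    measurable_comp_counts f hf (𝓑.measurable_mean.comp measurable_fst) measurable_snd
  have h2 : Measurable fun w : (Θ × (Fin t → Round m)) × (Fin m → ℝ) => f w.2 (counts w.1.2) :=
    measurable_comp_counts f hf measurable_snd (measurable_snd.comp measurable_fst)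
  rw [lintegral_stepLaw_sample 𝓑 ho prior t _ h2,
    ← lintegral_posterior 𝓑 ho hcascade hindep horacle prior hprior t f hf,
    ← (measurePreserving_fst_stepLaw 𝓑 ho prior t).lintegral_comp h1]

/-- The posterior identity with the counts ignored: averaged over the history, the posterior is the
prior. -/
lemma measurePreserving_sample_stepLaw (hcascade : 𝓑.CascadeTriggering)
    (hindep : 𝓑.IndependentOutcomes)
    (horacle : ∀ θ ∈ Icc (0 : Fin m → ℝ) 1, oracle θ ∈ 𝓑.superArms)
    (hprior : 𝓑.UniformMeanPrior prior) (t : ℕ) :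
    MeasurePreserving (fun w : (Θ × (Fin t → Round m)) × Round m => w.2.1)
      (stepLaw 𝓑 ho prior t) (cubeUniform m) := by
  have hm : Measurable fun w : (Θ × (Fin t → Round m)) × Round m => w.2.1 := by fun_prop
  refine ⟨hm, Measure.ext_of_lintegral _ fun f hf => ?_⟩
  rw [lintegral_map hf hm, ← (measurePreserving_mean_stepLaw 𝓑 ho prior hprior t).lintegral_comp hf]
  exact (lintegral_stepLaw_mean 𝓑 ho prior hcascade hindep horacle hprior t (fun x _ => f x)
    fun _ => hf).symm

/-- Squared deviation from the posterior mean of the arm `i`, weighted by its number of pulls. -/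
@[irreducible] noncomputable def weightedSqDev (i : Fin m) (x : Fin m → ℝ) (c : (Fin m → ℕ) × (Fin m → ℕ)) :
    ENNReal :=
  ENNReal.ofReal ((c.1 i + c.2 i + 1) * (x i - postMean c i) ^ 2)

lemma measurable_weightedSqDev (i : Fin m) (c : (Fin m → ℕ) × (Fin m → ℕ)) :
    Measurable fun x => weightedSqDev i x c := by
  unfold weightedSqDev; fun_prop

lemma lintegral_weightedSqDev_le (c : (Fin m → ℕ) × (Fin m → ℕ)) (i : Fin m) :
    ∫⁻ x, weightedSqDev i x c ∂(betaSample m c) ≤ ENNReal.ofReal (1 / 4) := by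
  simp only [weightedSqDev]
  exact lintegral_sq_sub_postMean_betaSample_le c i

/-- The inequality `(u - v)² ≤ 2u² + 2v²`, with both points measured from the common posterior mean.
-/
lemma ofReal_pulls_mul_sq_le {t : ℕ} (h : Fin t → Round m) (i : Fin m) (x y : Fin m → ℝ) :
    ENNReal.ofReal ((pulls h i + 1 : ℝ) * (x i - y i) ^ 2) ≤
      2 * weightedSqDev i x (counts h) + 2 * weightedSqDev i y (counts h) := by
  have h2 : (2 : ENNReal) = ENNReal.ofReal 2 := by simp
  simp only [weightedSqDev]
  rw [h2, ← ENNReal.ofReal_mul zero_le_two, ← ENNReal.ofReal_mul zero_le_two,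
    ← ENNReal.ofReal_add (by positivity) (by positivity)]
  refine ENNReal.ofReal_le_ofReal ?_
  simp only [pulls, Nat.cast_add]
  generalize postMean (counts h) i = p
  have hn : (0 : ℝ) ≤ (counts h).1 i + (counts h).2 i + 1 := by positivity
  nlinarith [mul_nonneg hn (sq_nonneg ((x i - p) + (y i - p)))]

/-- The sampled and the true mean of an arm that was triggered `n` times differ by about
`(n + 1) ^ (-1/2)` in mean square. -/
theorem integral_pulls_mul_sq_le (hcascade : 𝓑.CascadeTriggering)
    (hindep : 𝓑.IndependentOutcomes)
    (horacle : ∀ θ ∈ Icc (0 : Fin m → ℝ) 1, oracle θ ∈ 𝓑.superArms)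
    (hprior : 𝓑.UniformMeanPrior prior) (t : ℕ) (i : Fin m) :
    ∫ w, (pulls w.1.2 i + 1 : ℝ) * (w.2.1 i - 𝓑.mean w.1.1 i) ^ 2 ∂(stepLaw 𝓑 ho prior t) ≤ 1 := by
  have hf := measurable_weightedSqDev (m := m) i
  have hfw : Measurable fun w : (Θ × (Fin t → Round m)) × (Fin m → ℝ) =>
      weightedSqDev i w.2 (counts w.1.2) :=
    measurable_comp_counts (weightedSqDev i) hf measurable_snd (measurable_snd.comp measurable_fst)
  have hfw' : Measurable fun w : (Θ × (Fin t → Round m)) × Round m =>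
      weightedSqDev i w.2.1 (counts w.1.2) :=
    measurable_comp_counts (weightedSqDev i) hf (measurable_fst.comp measurable_snd)
      (measurable_snd.comp measurable_fst)
  have hθ : ∫⁻ w, weightedSqDev i w.2.1 (counts w.1.2) ∂(stepLaw 𝓑 ho prior t) ≤
      ENNReal.ofReal (1 / 4) := by
    refine (lintegral_stepLaw_sample 𝓑 ho prior t
      (fun w => weightedSqDev i w.2 (counts w.1.2)) hfw).trans_le ?_
    calc ∫⁻ ω, ∫⁻ θ, weightedSqDev i θ (counts ω.2) ∂(betaSample m (counts ω.2))
          ∂(bayesLaw 𝓑 ho prior t)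
        ≤ ∫⁻ _, ENNReal.ofReal (1 / 4) ∂(bayesLaw 𝓑 ho prior t) :=
          lintegral_mono fun ω => lintegral_weightedSqDev_le (counts ω.2) i
      _ = ENNReal.ofReal (1 / 4) := by rw [lintegral_const, measure_univ, mul_one]
  have hmw : Measurable fun w : (Θ × (Fin t → Round m)) × Round m =>
      (pulls w.1.2 i + 1 : ℝ) * (w.2.1 i - 𝓑.mean w.1.1 i) ^ 2 := by
    have h1 : Measurable fun w : (Θ × (Fin t → Round m)) × Round m => (pulls w.1.2 i : ℝ) :=
      measurable_from_top.comp ((measurable_pulls i).comp (measurable_snd.comp measurable_fst))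
    have h2 : Measurable fun w : (Θ × (Fin t → Round m)) × Round m => 𝓑.mean w.1.1 i :=
      (measurable_pi_apply i).comp
        (𝓑.measurable_mean.comp (measurable_fst.comp measurable_fst))
    fun_prop
  rw [integral_eq_lintegral_of_nonneg_ae (ae_of_all _ fun w => by positivity)
    hmw.aestronglyMeasurable]
  refine ENNReal.toReal_le_of_le_ofReal zero_le_one ?_
  calc ∫⁻ w, ENNReal.ofReal ((pulls w.1.2 i + 1 : ℝ) * (w.2.1 i - 𝓑.mean w.1.1 i) ^ 2)
        ∂(stepLaw 𝓑 ho prior t)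
      ≤ ∫⁻ w, (2 * weightedSqDev i w.2.1 (counts w.1.2) + 2 * weightedSqDev i (𝓑.mean w.1.1) (counts w.1.2))
        ∂(stepLaw 𝓑 ho prior t) := by
        exact lintegral_mono fun w => ofReal_pulls_mul_sq_le _ _ _ _
    -- By posterior sampling the true mean and the sample deviate equally; four times the variance
    -- bound `1/4` then gives 1.
    _ = 4 * ∫⁻ w, weightedSqDev i w.2.1 (counts w.1.2) ∂(stepLaw 𝓑 ho prior t) := by
        rw [lintegral_add_left (hfw'.const_mul _), lintegral_const_mul _ hfw',
          lintegral_const_mul' _ _ (by simp),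
          lintegral_stepLaw_mean 𝓑 ho prior hcascade hindep horacle hprior t (weightedSqDev i) hf, ← two_mul,
          ← mul_assoc]
        norm_num
    _ ≤ 4 * ENNReal.ofReal (1 / 4) := by gcongr
    _ = ENNReal.ofReal 1 := by
        rw [show (4 : ENNReal) = ENNReal.ofReal 4 by simp, ← ENNReal.ofReal_mul (by norm_num)]
        norm_num

/-- Charging the trigger probability of an arm to the harmonic numbers of its pulls. -/
lemma integral_trigProb_div_pulls (t : ℕ) (i : Fin m) :
    ∫ w, 𝓑.trigProb w.1.1 (oracle w.2.1) i / (pulls w.1.2 i + 1 : ℝ) ∂(stepLaw 𝓑 ho prior t) =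
      ∫ ω, (harmonic (pulls ω.2 i) : ℝ) ∂(bayesLaw 𝓑 ho prior (t + 1)) -
        ∫ ω, (harmonic (pulls ω.2 i) : ℝ) ∂(bayesLaw 𝓑 ho prior t) := by
  have hpulls : ∀ t : ℕ, Measurable fun h : Fin t → Round m => pulls h i :=
    fun _ => measurable_pulls i
  have hp := 𝓑.measurable_trigProb i
  have hpw : Measurable fun w : (Θ × (Fin t → Round m)) × Round m =>
      𝓑.trigProb w.1.1 (oracle w.2.1) i :=
    hp.comp (by fun_prop : Measurable
      fun w : (Θ × (Fin t → Round m)) × Round m => (w.1.1, oracle w.2.1))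
  have hN : Measurable fun h : Fin t → Round m => (pulls h i : ℝ) :=
    measurable_from_top.comp (hpulls t)
  have hH : ∀ {t : ℕ}, Measurable fun ω : Θ × (Fin t → Round m) =>
      (harmonic (pulls ω.2 i) : ℝ) := fun {t} =>
    (measurable_from_top (f := fun n : ℕ => (harmonic n : ℝ))).comp
      ((hpulls t).comp measurable_snd)
  have hmono : Monotone fun n : ℕ => (harmonic n : ℝ) := monotone_nat_of_le_succ fun n => by
    rw [harmonic_succ]; push_cast; linarith [show (0 : ℝ) ≤ ((n : ℝ) + 1)⁻¹ by positivity]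
  have hHi : ∀ t : ℕ, Integrable (fun ω : Θ × (Fin t → Round m) =>
      (harmonic (pulls ω.2 i) : ℝ)) (bayesLaw 𝓑 ho prior t) := fun t => by
    refine Integrable.of_bound hH.aestronglyMeasurable (harmonic t : ℝ) (ae_of_all _ fun ω => ?_)
    have h0 := hmono (Nat.zero_le (pulls ω.2 i))
    simp only [harmonic_zero, Rat.cast_zero] at h0
    rw [Real.norm_eq_abs, abs_of_nonneg h0]
    exact hmono (pulls_le ω.2 i)
  have hs := measurePreserving_snoc_stepLaw 𝓑 ho prior t
  have hfst := measurePreserving_fst_stepLaw 𝓑 ho prior t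
  have e1 : ∫ ω, (harmonic (pulls ω.2 i) : ℝ) ∂(bayesLaw 𝓑 ho prior (t + 1)) =
      ∫ w, (harmonic (pulls (Fin.snoc w.1.2 w.2 : Fin (t + 1) → Round m) i) : ℝ)
        ∂(stepLaw 𝓑 ho prior t) := by
    rw [← hs.map_eq, integral_map hs.aemeasurable hH.aestronglyMeasurable]
  have e2 : ∫ ω, (harmonic (pulls ω.2 i) : ℝ) ∂(bayesLaw 𝓑 ho prior t) =
      ∫ w, (harmonic (pulls w.1.2 i) : ℝ) ∂(stepLaw 𝓑 ho prior t) := by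
    rw [← hfst.map_eq, integral_map hfst.aemeasurable hH.aestronglyMeasurable]
  have i1 : Integrable (fun w : (Θ × (Fin t → Round m)) × Round m =>
      (harmonic (pulls (Fin.snoc w.1.2 w.2 : Fin (t + 1) → Round m) i) : ℝ))
      (stepLaw 𝓑 ho prior t) := hs.integrable_comp_of_integrable (hHi (t + 1))
  have i2 : Integrable (fun w : (Θ × (Fin t → Round m)) × Round m =>
      (harmonic (pulls w.1.2 i) : ℝ)) (stepLaw 𝓑 ho prior t) :=
    hfst.integrable_comp_of_integrable (hHi t)
  -- A triggering moves the count from `N` to `N + 1` and the harmonic number by exactly `1/(N +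
  -- 1)`.
  have e3 : ∀ w : (Θ × (Fin t → Round m)) × Round m,
      (harmonic (pulls (Fin.snoc w.1.2 w.2 : Fin (t + 1) → Round m) i) : ℝ) -
        harmonic (pulls w.1.2 i) =
      (pulls w.1.2 i + 1 : ℝ)⁻¹ * {A : Finset (Fin m) | i ∈ A}.indicator 1 w.2.2.2.1 := by
    intro w
    rw [pulls_snoc]
    by_cases hi : i ∈ w.2.2.2.1
    · simp [hi, harmonic_succ]
    · simp [hi]
  have hind : Measurable fun w : (Θ × (Fin t → Round m)) × Round m =>
      {A : Finset (Fin m) | i ∈ A}.indicator (1 : Finset (Fin m) → ℝ) w.2.2.2.1 :=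
    (measurable_one.indicator (Set.toFinite _).measurableSet).comp (by fun_prop)
  rw [e1, e2, ← integral_sub i1 i2]
  simp only [e3]
  rw [integral_eq_lintegral_of_nonneg_ae, integral_eq_lintegral_of_nonneg_ae]
  · congr 1
    have key := lintegral_stepLaw_trigProb 𝓑 ho prior t i
      (fun h => ENNReal.ofReal (pulls h i + 1 : ℝ)⁻¹) (by fun_prop)
    convert key using 1
    · refine lintegral_congr fun w => ?_
      rw [← ENNReal.ofReal_mul (by positivity), div_eq_inv_mul]
    · refine lintegral_congr fun w => ?_
      by_cases hi : i ∈ w.2.2.2.1 <;> simp [hi]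
  · refine ae_of_all _ fun w => mul_nonneg (by positivity) (indicator_nonneg (by simp) _)
  · exact Measurable.aestronglyMeasurable (by fun_prop)
  · exact ae_of_all _ fun w => div_nonneg (𝓑.trigProb_nonneg _ _ _) (by positivity)
  · exact Measurable.aestronglyMeasurable (by fun_prop)

/-- AM-GM in the form `(c - n|δ|)² ≥ 0`. The factor `p` is kept on `1/n`, where it will be charged
to triggerings, and bounded by 1 on the square. -/
lemma mul_abs_le_of_le_one {p n δ c : ℝ} (hp0 : 0 ≤ p) (hp1 : p ≤ 1) (hn : 0 < n) (hc : 0 < c) :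
    p * |δ| ≤ c / 2 * (p / n) + 1 / (2 * c) * (n * δ ^ 2) := by
  have h1 : 2 * |δ| ≤ c / n + n * δ ^ 2 / c := by
    have h := sq_nonneg (c - n * |δ|)
    have h2 : n * c * (2 * |δ|) ≤ n * c * (c / n + n * δ ^ 2 / c) := by
      have : n * c * (c / n + n * δ ^ 2 / c) = c ^ 2 + n ^ 2 * δ ^ 2 := by field_simp
      rw [this, ← sq_abs δ]
      nlinarith
    exact le_of_mul_le_mul_left h2 (by positivity)
  calc p * |δ| ≤ p * ((c / n + n * δ ^ 2 / c) / 2) := by gcongr; linarith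
    _ = c / 2 * (p / n) + p * (n * δ ^ 2 / c / 2) := by ring
    _ ≤ c / 2 * (p / n) + 1 * (n * δ ^ 2 / c / 2) := by gcongr
    _ = _ := by ring

end

/-! ### Bayesian regret of one round and of all rounds. -/

section

variable {m : ℕ} {Θ : Type*} [MeasurableSpace Θ]


/-- Gap of the super arm played for the sampled parameter vector `θ`, for an extension `g` of the
expected reward. -/
noncomputable def sampleGap (𝓑 : Bandit m Θ) (g : Finset (Fin m) → (Fin m → ℝ) → ℝ)
    (oracle : (Fin m → ℝ) → Finset (Fin m)) (e : Θ) (θ : Fin m → ℝ) : ℝ :=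
  𝓑.maxReward g (𝓑.mean e) - g (oracle θ) (𝓑.mean e)

variable (𝓑 : Bandit m Θ) {oracle : (Fin m → ℝ) → Finset (Fin m)} (ho : Measurable oracle)
  (prior : Measure Θ) [IsProbabilityMeasure prior]

lemma measurable_reward_comp (ho : Measurable oracle)
    {g : Finset (Fin m) → (Fin m → ℝ) → ℝ} (hg : ∀ S, Continuous (g S)) :
    Measurable fun p : (Fin m → ℝ) × (Fin m → ℝ) => g (oracle p.1) p.2 :=
  (measurable_from_prod_countable_left fun S => (hg S).measurable :
    Measurable fun q : (Fin m → ℝ) × Finset (Fin m) => g q.2 q.1).comp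
      (measurable_snd.prodMk (ho.comp measurable_fst))

lemma measurable_sampleGap (ho : Measurable oracle)
    {g : Finset (Fin m) → (Fin m → ℝ) → ℝ} (hg : ∀ S, Continuous (g S)) :
    Measurable fun p : Θ × (Fin m → ℝ) => sampleGap 𝓑 g oracle p.1 p.2 :=
  ((𝓑.continuous_maxReward hg).measurable.comp (𝓑.measurable_mean.comp measurable_fst)).sub
    ((measurable_reward_comp ho hg).comp
      (measurable_snd.prodMk (𝓑.measurable_mean.comp measurable_fst)))

/-- Mean harmonic number of the number of pulls of the arm `i` in `t` rounds. -/
noncomputable def meanHarmonicPulls (t : ℕ) (i : Fin m) : ℝ :=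
  ∫ ω, (harmonic (pulls ω.2 i) : ℝ) ∂(bayesLaw 𝓑 ho prior t)

/-- The Bayesian regret of one round. -/
theorem integral_sampleGap_le (hcascade : 𝓑.CascadeTriggering) (hindep : 𝓑.IndependentOutcomes)
    {r g : Finset (Fin m) → (Fin m → ℝ) → ℝ} {B : ℝ} (hB : 0 < B) (hlip : 𝓑.TPMLipschitz r B)
    (hprior : 𝓑.UniformMeanPrior prior) (hexact : 𝓑.IsExactOracle r oracle)
    (hg : ∀ S, Continuous (g S)) (hgr : ∀ S ∈ 𝓑.superArms, ∀ e, g S (𝓑.mean e) = r S (𝓑.mean e))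
    (t : ℕ) {c : ℝ} (hc : 0 < c) :
    Integrable (fun w => sampleGap 𝓑 g oracle w.1.1 w.2.1) (stepLaw 𝓑 ho prior t) ∧
      ∫ w, sampleGap 𝓑 g oracle w.1.1 w.2.1 ∂(stepLaw 𝓑 ho prior t) ≤
        B * ∑ i, (c / 2 * (meanHarmonicPulls 𝓑 ho prior (t + 1) i -
          meanHarmonicPulls 𝓑 ho prior t i) + 1 / (2 * c)) := by
  have horacle : ∀ θ ∈ Icc (0 : Fin m → ℝ) 1, oracle θ ∈ 𝓑.superArms :=
    fun θ hθ => (hexact θ hθ).1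
  have hμ := measurePreserving_mean_stepLaw 𝓑 ho prior hprior t
  have hθ := measurePreserving_sample_stepLaw 𝓑 ho prior hcascade hindep horacle hprior t
  have hmax := (𝓑.continuous_maxReward hg).measurable
  obtain ⟨C, hC⟩ := exists_forall_abs_le hg
  have hIcc : ∀ᵐ θ ∂(cubeUniform m), θ ∈ Icc (0 : Fin m → ℝ) 1 := by
    rw [cubeUniform_eq]; exact ae_restrict_mem measurableSet_Icc
  have hcl : ∀ᵐ θ ∂(cubeUniform m), θ ∈ closure (range 𝓑.mean) :=
    𝓑.ae_cubeUniform_of_forall_mean hprior isClosed_closure.measurableSet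
      fun e => subset_closure ⟨e, rfl⟩
  have hIccθ := hθ.quasiMeasurePreserving.ae hIcc
  have hclθ := hθ.quasiMeasurePreserving.ae hcl
  have hoptθ := hθ.quasiMeasurePreserving.ae
    (𝓑.ae_oracle_optimal hg hgr hprior ho hexact)
  have hmaxμm : Measurable fun w : (Θ × (Fin t → Round m)) × Round m =>
      𝓑.maxReward g (𝓑.mean w.1.1) := hmax.comp hμ.measurable
  have hmaxθm : Measurable fun w : (Θ × (Fin t → Round m)) × Round m =>
      𝓑.maxReward g w.2.1 := hmax.comp hθ.measurable
  have hrm : Measurable fun w : (Θ × (Fin t → Round m)) × Round m =>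
      g (oracle w.2.1) (𝓑.mean w.1.1) :=
    (measurable_reward_comp ho hg).comp (hθ.measurable.prodMk hμ.measurable)
  have hmaxμ : Integrable (fun w : (Θ × (Fin t → Round m)) × Round m =>
      𝓑.maxReward g (𝓑.mean w.1.1)) (stepLaw 𝓑 ho prior t) :=
    Integrable.of_bound hmaxμm.aestronglyMeasurable C
      (ae_of_all _ fun w => abs_maxReward_le 𝓑 fun S => hC S _ (𝓑.mean_mem_Icc _))
  have hmaxθ : Integrable (fun w : (Θ × (Fin t → Round m)) × Round m =>
      𝓑.maxReward g w.2.1) (stepLaw 𝓑 ho prior t) :=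
    Integrable.of_bound hmaxθm.aestronglyMeasurable C
      (hIccθ.mono fun w hw => abs_maxReward_le 𝓑 fun S => hC S _ hw)
  have hr : Integrable (fun w : (Θ × (Fin t → Round m)) × Round m =>
      g (oracle w.2.1) (𝓑.mean w.1.1)) (stepLaw 𝓑 ho prior t) :=
    Integrable.of_bound hrm.aestronglyMeasurable C
      (ae_of_all _ fun w => hC _ _ (𝓑.mean_mem_Icc _))
  -- Here posterior sampling enters the regret: `μ` and `θ` have the same law, so the unknown
  -- optimum can be replaced by the optimum at `θ`, which the oracle attains.
  have hswap : ∫ w, 𝓑.maxReward g (𝓑.mean w.1.1) ∂(stepLaw 𝓑 ho prior t) =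
      ∫ w, 𝓑.maxReward g w.2.1 ∂(stepLaw 𝓑 ho prior t) := by
    rw [← integral_map hμ.aemeasurable (f := 𝓑.maxReward g) hmax.aestronglyMeasurable,
      ← integral_map hθ.aemeasurable (f := 𝓑.maxReward g) hmax.aestronglyMeasurable,
      hμ.map_eq, hθ.map_eq]
  have hN : Measurable fun w : (Θ × (Fin t → Round m)) × Round m => w.1.2 :=
    measurable_snd.comp measurable_fst
  have hpulls : ∀ i, Measurable fun w : (Θ × (Fin t → Round m)) × Round m =>
      (pulls w.1.2 i : ℝ) := fun i => measurable_from_top.comp ((measurable_pulls i).comp hN)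
  have hp : ∀ i, Measurable fun w : (Θ × (Fin t → Round m)) × Round m =>
      𝓑.trigProb w.1.1 (oracle w.2.1) i := fun i =>
    (𝓑.measurable_trigProb i).comp
      ((measurable_fst.comp measurable_fst).prodMk (ho.comp hθ.measurable))
  have hμi : ∀ i, Measurable fun w : (Θ × (Fin t → Round m)) × Round m => 𝓑.mean w.1.1 i :=
    fun i => (measurable_pi_apply i).comp hμ.measurable
  have hint1 : ∀ i, Integrable (fun w : (Θ × (Fin t → Round m)) × Round m =>
      𝓑.trigProb w.1.1 (oracle w.2.1) i / (pulls w.1.2 i + 1 : ℝ)) (stepLaw 𝓑 ho prior t) := by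
    intro i
    have hm := (hp i).div ((hpulls i).add_const 1)
    refine Integrable.of_bound hm.aestronglyMeasurable 1 (ae_of_all _ fun w => ?_)
    have h0 := 𝓑.trigProb_nonneg w.1.1 (oracle w.2.1) i
    have h1 := 𝓑.trigProb_le_one w.1.1 (oracle w.2.1) i
    rw [Real.norm_eq_abs, abs_of_nonneg (by positivity), div_le_one (by positivity)]
    have : (0 : ℝ) ≤ pulls w.1.2 i := by positivity
    linarith
  have hint2 : ∀ i, Integrable (fun w : (Θ × (Fin t → Round m)) × Round m =>
      (pulls w.1.2 i + 1 : ℝ) * (w.2.1 i - 𝓑.mean w.1.1 i) ^ 2) (stepLaw 𝓑 ho prior t) := by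
    intro i
    have hm : Measurable fun w : (Θ × (Fin t → Round m)) × Round m =>
        (pulls w.1.2 i + 1 : ℝ) * (w.2.1 i - 𝓑.mean w.1.1 i) ^ 2 :=
      ((hpulls i).add_const 1).mul
        ((((measurable_pi_apply i).comp hθ.measurable).sub (hμi i)).pow_const 2)
    refine Integrable.of_bound hm.aestronglyMeasurable (t + 1 : ℝ) (hIccθ.mono fun w hw => ?_)
    have h1 : (pulls w.1.2 i : ℝ) ≤ t := by exact_mod_cast pulls_le w.1.2 i
    have h2 := 𝓑.mean_mem_Icc w.1.1
    have h3 : (w.2.1 i - 𝓑.mean w.1.1 i) ^ 2 ≤ 1 := by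
      rw [sq_le_one_iff_abs_le_one, abs_le]
      have a1 := hw.1 i
      have a2 := hw.2 i
      have a3 := h2.1 i
      have a4 := h2.2 i
      simp only [Pi.zero_apply, Pi.one_apply] at a1 a2 a3 a4
      constructor <;> linarith
    rw [Real.norm_eq_abs, abs_of_nonneg (by positivity)]
    calc (pulls w.1.2 i + 1 : ℝ) * (w.2.1 i - 𝓑.mean w.1.1 i) ^ 2
        ≤ (pulls w.1.2 i + 1 : ℝ) * 1 := by gcongr
      _ ≤ t + 1 := by linarith
  have hsum : ∀ i, Integrable (fun w : (Θ × (Fin t → Round m)) × Round m =>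
      c / 2 * (𝓑.trigProb w.1.1 (oracle w.2.1) i / (pulls w.1.2 i + 1 : ℝ)) +
        1 / (2 * c) * ((pulls w.1.2 i + 1 : ℝ) * (w.2.1 i - 𝓑.mean w.1.1 i) ^ 2))
      (stepLaw 𝓑 ho prior t) := fun i => ((hint1 i).const_mul _).add ((hint2 i).const_mul _)
  refine ⟨hmaxμ.sub hr, ?_⟩
  calc ∫ w, sampleGap 𝓑 g oracle w.1.1 w.2.1 ∂(stepLaw 𝓑 ho prior t)
      = ∫ w, (𝓑.maxReward g w.2.1 - g (oracle w.2.1) (𝓑.mean w.1.1)) ∂(stepLaw 𝓑 ho prior t) := by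
        simp only [sampleGap]
        rw [integral_sub hmaxμ hr, integral_sub hmaxθ hr, hswap]
    _ ≤ ∫ w, B * ∑ i, (c / 2 * (𝓑.trigProb w.1.1 (oracle w.2.1) i / (pulls w.1.2 i + 1 : ℝ)) +
        1 / (2 * c) * ((pulls w.1.2 i + 1 : ℝ) * (w.2.1 i - 𝓑.mean w.1.1 i) ^ 2))
          ∂(stepLaw 𝓑 ho prior t) := by
        refine integral_mono_ae (hmaxθ.sub hr)
          ((integrable_finsetSum _ fun i _ => hsum i).const_mul B) ?_
        -- Almost surely the super arm played is feasible, the modulated Lipschitz bound reaches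
        -- `θ`, and the oracle is optimal for `g` at `θ`.
        filter_upwards [hIccθ, hclθ, hoptθ] with w h1 h2 h3
        have h4 := hlip.abs_sub_le_of_mem_closure hg hgr (horacle _ h1) w.1.1 h2
        simp only [h3]
        refine (le_abs_self _).trans ((abs_sub_comm _ _).trans_le (h4.trans ?_))
        gcongr with i
        rw [abs_sub_comm]
        exact mul_abs_le_of_le_one (𝓑.trigProb_nonneg _ _ _) (𝓑.trigProb_le_one _ _ _)
          (by positivity) hc
    _ = B * ∑ i, (c / 2 * (meanHarmonicPulls 𝓑 ho prior (t + 1) i -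
          meanHarmonicPulls 𝓑 ho prior t i) + 1 / (2 * c) *
          ∫ w, (pulls w.1.2 i + 1 : ℝ) * (w.2.1 i - 𝓑.mean w.1.1 i) ^ 2
            ∂(stepLaw 𝓑 ho prior t)) := by
        rw [integral_const_mul, integral_finsetSum _ fun i _ => hsum i]
        congr 1
        refine Finset.sum_congr rfl fun i _ => ?_
        rw [integral_add ((hint1 i).const_mul _) ((hint2 i).const_mul _), integral_const_mul,
          integral_const_mul, integral_trigProb_div_pulls 𝓑 ho prior t i]
        rfl
    _ ≤ _ := by
        gcongr with i
        exact mul_le_of_le_one_right (by positivity)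
          (integral_pulls_mul_sq_le 𝓑 ho prior hcascade hindep horacle hprior t i)

/-- Total gap over `t` rounds, for an extension `g` of the expected reward. -/
noncomputable def extendedRegret (g : Finset (Fin m) → (Fin m → ℝ) → ℝ)
    (oracle : (Fin m → ℝ) → Finset (Fin m)) (t : ℕ) (ω : Θ × (Fin t → Round m)) : ℝ :=
  ∑ s : Fin t, sampleGap 𝓑 g oracle ω.1 (ω.2 s).1

lemma measurable_extendedRegret (ho : Measurable oracle)
    {g : Finset (Fin m) → (Fin m → ℝ) → ℝ}
    (hg : ∀ S, Continuous (g S)) (t : ℕ) : Measurable (extendedRegret 𝓑 g oracle t) :=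
  Finset.measurable_sum _ fun s _ => (measurable_sampleGap 𝓑 ho hg).comp
    (by fun_prop : Measurable fun ω : Θ × (Fin t → Round m) => (ω.1, (ω.2 s).1))

theorem integral_extendedRegret_le (hcascade : 𝓑.CascadeTriggering)
    (hindep : 𝓑.IndependentOutcomes)
    {r g : Finset (Fin m) → (Fin m → ℝ) → ℝ} {B : ℝ} (hB : 0 < B) (hlip : 𝓑.TPMLipschitz r B)
    (hprior : 𝓑.UniformMeanPrior prior) (hexact : 𝓑.IsExactOracle r oracle)
    (hg : ∀ S, Continuous (g S)) (hgr : ∀ S ∈ 𝓑.superArms, ∀ e, g S (𝓑.mean e) = r S (𝓑.mean e))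
    {c : ℝ} (hc : 0 < c) (t : ℕ) :
    Integrable (extendedRegret 𝓑 g oracle t) (bayesLaw 𝓑 ho prior t) ∧
      ∫ ω, extendedRegret 𝓑 g oracle t ω ∂(bayesLaw 𝓑 ho prior t) ≤
        B * ∑ i, (c / 2 * meanHarmonicPulls 𝓑 ho prior t i + t / (2 * c)) := by
  induction t with
  | zero =>
    have h0 : extendedRegret 𝓑 g oracle 0 = fun _ => 0 := by
      ext ω; simp [extendedRegret]
    rw [h0]
    refine ⟨integrable_zero _ _ _, ?_⟩
    simp only [integral_zero, meanHarmonicPulls, Nat.cast_zero, zero_div, add_zero]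
    have hz : ∀ (ω : Θ × (Fin 0 → Round m)) (i : Fin m), pulls ω.2 i = 0 :=
      fun ω i => Nat.le_zero.1 (pulls_le ω.2 i)
    simp [hz]
  | succ t ih =>
    obtain ⟨hi, hle⟩ := ih
    obtain ⟨hi', hle'⟩ := integral_sampleGap_le 𝓑 ho prior hcascade hindep hB hlip hprior hexact
      hg hgr t hc
    have hs := measurePreserving_snoc_stepLaw 𝓑 ho prior t
    have hfst := measurePreserving_fst_stepLaw 𝓑 ho prior t
    have hm := measurable_extendedRegret 𝓑 ho hg
    have hsplit : ∀ w : (Θ × (Fin t → Round m)) × Round m,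
        extendedRegret 𝓑 g oracle (t + 1) (w.1.1, (Fin.snoc w.1.2 w.2 : Fin (t + 1) → Round m)) =
          extendedRegret 𝓑 g oracle t w.1 + sampleGap 𝓑 g oracle w.1.1 w.2.1 := by
      intro w
      simp only [extendedRegret, Fin.sum_univ_castSucc, Fin.snoc_castSucc, Fin.snoc_last]
    have hi1 : Integrable (fun w => extendedRegret 𝓑 g oracle t w.1) (stepLaw 𝓑 ho prior t) :=
      hfst.integrable_comp_of_integrable hi
    have hi2 : Integrable (fun w : (Θ × (Fin t → Round m)) × Round m =>
        extendedRegret 𝓑 g oracle (t + 1) (w.1.1, (Fin.snoc w.1.2 w.2 : Fin (t + 1) → Round m)))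
        (stepLaw 𝓑 ho prior t) := by
      simp only [hsplit]
      exact hi1.add hi'
    refine ⟨(hs.integrable_comp (hm (t + 1)).aestronglyMeasurable).1 hi2, ?_⟩
    rw [← hs.map_eq, integral_map hs.aemeasurable (hm (t + 1)).aestronglyMeasurable]
    simp only [hsplit]
    have e1 : ∫ w, extendedRegret 𝓑 g oracle t w.1 ∂(stepLaw 𝓑 ho prior t) =
        ∫ ω, extendedRegret 𝓑 g oracle t ω ∂(bayesLaw 𝓑 ho prior t) := by
      rw [← hfst.map_eq, integral_map hfst.aemeasurable (hm t).aestronglyMeasurable]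
    rw [integral_add hi1 hi', e1]
    refine (add_le_add hle hle').trans_eq ?_
    rw [← mul_add, ← Finset.sum_add_distrib]
    congr 1
    refine Finset.sum_congr rfl fun i _ => ?_
    push_cast
    ring

/-- The oracle is constrained only on the cube, so this is what makes every super arm played
feasible, and there `g` agrees with `r` at mean vectors. -/
lemma ae_forall_sample_mem_Icc (hcascade : 𝓑.CascadeTriggering) (hindep : 𝓑.IndependentOutcomes)
    (horacle : ∀ θ ∈ Icc (0 : Fin m → ℝ) 1, oracle θ ∈ 𝓑.superArms)
    (hprior : 𝓑.UniformMeanPrior prior) (t : ℕ) :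
    ∀ᵐ ω ∂(bayesLaw 𝓑 ho prior t), ∀ s : Fin t, (ω.2 s).1 ∈ Icc (0 : Fin m → ℝ) 1 := by
  induction t with
  | zero => exact ae_of_all _ fun ω s => s.elim0
  | succ t ih =>
    have hθ := measurePreserving_sample_stepLaw 𝓑 ho prior hcascade hindep horacle hprior t
    have hfst := measurePreserving_fst_stepLaw 𝓑 ho prior t
    have hs := measurePreserving_snoc_stepLaw 𝓑 ho prior t
    have hIcc : ∀ᵐ θ ∂(cubeUniform m), θ ∈ Icc (0 : Fin m → ℝ) 1 := by
      rw [cubeUniform_eq]; exact ae_restrict_mem measurableSet_Icc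
    have hms : MeasurableSet {ω : Θ × (Fin (t + 1) → Round m) |
        ∀ s, (ω.2 s).1 ∈ Icc (0 : Fin m → ℝ) 1} := by
      rw [ofPred_forall]
      exact MeasurableSet.iInter fun s => measurableSet_Icc.preimage
        (by fun_prop : Measurable fun ω : Θ × (Fin (t + 1) → Round m) => (ω.2 s).1)
    rw [← hs.map_eq]
    refine (ae_map_iff hs.aemeasurable hms).2 ?_
    filter_upwards [hθ.quasiMeasurePreserving.ae hIcc, hfst.quasiMeasurePreserving.ae ih]
      with w h1 h2 s
    refine Fin.lastCases ?_ (fun j => ?_) s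
    · simpa only [Fin.snoc_last] using h1
    · simpa only [Fin.snoc_castSucc] using h2 j

lemma meanHarmonicPulls_le {t : ℕ} (i : Fin m) :
    meanHarmonicPulls 𝓑 ho prior t i ≤ 1 + Real.log t := by
  have hb : ∀ ω : Θ × (Fin t → Round m), (harmonic (pulls ω.2 i) : ℝ) ≤ 1 + Real.log t := by
    intro ω
    rcases Nat.eq_zero_or_pos (pulls ω.2 i) with h | h
    · rw [h, harmonic_zero, Rat.cast_zero]
      have := Real.log_natCast_nonneg t
      linarith
    · have h1 : (pulls ω.2 i : ℝ) ≤ t := by exact_mod_cast pulls_le ω.2 i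
      have h2 : (0 : ℝ) < pulls ω.2 i := by exact_mod_cast h
      have := Real.log_le_log h2 h1
      linarith [harmonic_le_one_add_log (pulls ω.2 i)]
  refine (integral_mono_of_nonneg (ae_of_all _ fun ω => ?_)
    (integrable_const (1 + Real.log t)) (ae_of_all _ hb)).trans (by simp)
  have : (0 : ℚ) ≤ harmonic (pulls ω.2 i) := Finset.sum_nonneg fun _ _ => by positivity
  exact Rat.cast_nonneg.2 this

end

end CMAB

/-! ### The regret bound: choice of the AM-GM weight. -/

theorem theorem3 {m : ℕ} {Θ : Type*} [MeasurableSpace Θ] (𝓑 : CMAB.Bandit m Θ)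
    (hcascade : 𝓑.CascadeTriggering)
    (hindep : 𝓑.IndependentOutcomes)
    (r : Finset (Fin m) → (Fin m → ℝ) → ℝ) (hr : 𝓑.IsExpectedReward r)
    (B : ℝ) (hB : 0 < B) (hlip : 𝓑.TPMLipschitz r B)
    (hmono : 𝓑.MonotoneReward r)
    (prior : Measure Θ) [IsProbabilityMeasure prior] (hprior : 𝓑.UniformMeanPrior prior)
    (oracle : (Fin m → ℝ) → Finset (Fin m)) (ho : Measurable oracle)
    (hexact : 𝓑.IsExactOracle r oracle) (T : ℕ) :
    Integrable (CMAB.pseudoRegret 𝓑 r oracle T) (CMAB.bayesLaw 𝓑 ho prior T) ∧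
      CMAB.bayesRegret 𝓑 r ho prior T ≤
        16 * m * B * (1 + √2) * √((1 + 4 * Real.log T) * T) + 4 * m * B + 8 * (m : ℝ) ^ 2 * B := by
  obtain ⟨g, hg, hgr⟩ := hlip.exists_continuous_extension hB
  have horacle : ∀ θ ∈ Icc (0 : Fin m → ℝ) 1, oracle θ ∈ 𝓑.superArms :=
    fun θ hθ => (hexact θ hθ).1
  have hae : CMAB.pseudoRegret 𝓑 r oracle T =ᵐ[CMAB.bayesLaw 𝓑 ho prior T]
      CMAB.extendedRegret 𝓑 g oracle T := by
    filter_upwards [CMAB.ae_forall_sample_mem_Icc 𝓑 ho prior hcascade hindep horacle hprior T]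
      with ω hω
    exact Finset.sum_congr rfl fun s _ => 𝓑.gap_eq hgr (horacle _ (hω s)) ω.1
  have key := fun (c : ℝ) (hc : 0 < c) => CMAB.integral_extendedRegret_le 𝓑 ho prior hcascade
    hindep hB hlip hprior hexact hg hgr hc T
  refine ⟨(key 1 one_pos).1.congr hae.symm, ?_⟩
  rw [CMAB.bayesRegret, integral_congr_ae hae]
  have hlog := Real.log_natCast_nonneg T
  have h2 : 0 ≤ √2 := Real.sqrt_nonneg 2
  have hrest : 0 ≤ 4 * m * B + 8 * (m : ℝ) ^ 2 * B := by positivity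
  -- The weight chosen below is positive only when `T > 0`.
  rcases Nat.eq_zero_or_pos T with hT | hT
  · subst hT
    have h0 : CMAB.extendedRegret 𝓑 g oracle 0 = fun _ => 0 := by
      ext ω; simp [CMAB.extendedRegret]
    simp only [h0, integral_zero]
    positivity
  have hT' : (0 : ℝ) < T := by exact_mod_cast hT
  set L : ℝ := 1 + Real.log T with hL
  have hLpos : 0 < L := by positivity
  -- The weight `c = √(T/L)` balances `c L / 2` against `T / (2c)`; both become `√(L T) / 2`.
  have hTL : 0 < √(T / L) := Real.sqrt_pos.2 (by positivity)
  calc ∫ ω, CMAB.extendedRegret 𝓑 g oracle T ω ∂(CMAB.bayesLaw 𝓑 ho prior T)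
      ≤ B * ∑ i, (√(T / L) / 2 * CMAB.meanHarmonicPulls 𝓑 ho prior T i +
          T / (2 * √(T / L))) := (key _ hTL).2
    _ ≤ B * ∑ _i : Fin m, (√(T / L) / 2 * L + T / (2 * √(T / L))) := by
        gcongr with i
        exact CMAB.meanHarmonicPulls_le 𝓑 ho prior i
    _ = m * B * √(L * T) := by
        have e1 : √(T / L) * L = √(L * T) := by
          calc √(T / L) * L = √(T / L) * √(L ^ 2) := by rw [Real.sqrt_sq hLpos.le]
            _ = √(T / L * L ^ 2) := (Real.sqrt_mul (by positivity) _).symm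
            _ = √(L * T) := by congr 1; field_simp
        have e2 : T / √(T / L) = √(L * T) := by
          rw [div_eq_iff hTL.ne', ← Real.sqrt_mul (by positivity)]
          rw [show L * T * (T / L) = T ^ 2 by field_simp, Real.sqrt_sq hT'.le]
        have e3 : √(T / L) / 2 * L + T / (2 * √(T / L)) = √(L * T) := by
          rw [div_mul_eq_mul_div, e1, mul_comm (2 : ℝ), ← div_div, e2]
          ring
        rw [e3]
        simp
        ring
    -- From here on the bound is only weakened, to reach the stated constants.
    _ ≤ m * B * √((1 + 4 * Real.log T) * T) := by
        gcongr
        linarith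
    _ = 1 * (m * B * √((1 + 4 * Real.log T) * T)) := (one_mul _).symm
    _ ≤ (16 * (1 + √2)) * (m * B * √((1 + 4 * Real.log T) * T)) := by
        gcongr
        linarith
    _ ≤ _ := by linarith
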